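/- Let $\mathcal S$ be the space of complex sequences $f=(f(n))_{n\in\mathbb Z}$ with $\sup_n |n|^k|f(n)|<\infty$ for all $k\ge 0$. Let $u=(Q,R)^T\in\mathcal S^2$ be a potential with $\gamma_n^2:=1-Q_nR_n\neq 0$ for all $n$. Let $(Ef)(n)=f(n+1)$ and, for a fixed $\theta\in\mathbb C$, $$((E-1)^{-1}f)(n)=\theta\sum_{k<n}f(k)-(1-\theta)\sum_{k\ge n}f(k)$$ (so $\theta=1$, $0$, $\tfrac12$ give the sum from $-\infty$, the sum to $+\infty$ and the symmetric choice). Define operators on $\mathcal S^2$ by $$L=\begin{pmatrix}E&0\\0&E^{-1}\end{pmatrix}+\begin{pmatrix}-Q_nE\\R_n\end{pmatrix}(E-1)^{-1}(R_nE,\;Q_nE^{-1})+\gamma_n^2\begin{pmatrix}-EQ_n\\R_{n-1}\end{pmatrix}(E-1)^{-1}(R_n,\;Q_n)\frac1{\gamma_n^2},$$ $$L^{-1}=\begin{pmatrix}E^{-1}&0\\0&E\end{pmatrix}+\begin{pmatrix}Q_n\\-R_nE\end{pmatrix}(E-1)^{-1}(R_nE^{-1},\;Q_nE)+\gamma_n^2\begin{pmatrix}Q_{n-1}\\-ER_n\end{pmatrix}(E-1)^{-1}(R_n,\;Q_n)\frac1{\gamma_n^2},$$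 and $\mathcal L=L-2I+L^{-1}$. Put $K^{(0)}=(Q_n,-R_n)^T$, $\sigma^{(0)}=(2n+1)(Q_n,-R_n)^T$, $$K^{(0)}_{[0]}=K^{(0)},\quad K^{(0)}_{[1]}=\tfrac12(L-L^{-1})K^{(0)},\quad \sigma^{(0)}_{[0]}=\tfrac12\sigma^{(0)},\quad \sigma^{(0)}_{[1]}=\tfrac14(L-L^{-1})\sigma^{(0)},$$ and, for $m=0,1,2,\dots$ and $j\in\{0,1\}$, $K^{(m)}_{[j]}=\mathcal L^mK^{(0)}_{[j]}$ and $\sigma^{(m)}_{[j]}=\mathcal L^m\sigma^{(0)}_{[j]}$ (the DAKNS flows). For a vector field $F$, a potential-dependent operator $\Phi$ and $g,h\in\mathcal S^2$ let $F'[g]=\frac{d}{d\epsilon}\big|_{\epsilon=0}F(u+\epsilon g)$ and $\Phi'[g]h=\frac{d}{d\epsilon}\big|_{\epsilon=0}\Phi(u+\epsilon g)h$ with $\epsilon\in\mathbb R$ (derivatives taken at each $n$). Write $F'$ for the operator $h\mapsto F'[h]$, and $[A,B]=AB-BA$. Then the following objects are well defined: $L$ and $L^{-1}$ map $\mathcal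 S^2$ to itself and are inverse to each other; the flows lie in $\mathcal S^2$; and all Gateaux derivatives of $L$, $L^{-1}$, $\mathcal L$ (applied to a fixed $h\in\mathcal S^2$) and of the flows in directions $g\in\mathcal S^2$ exist and lie in $\mathcal S^2$. For every $m\ge 0$, the following identities between operators on $\mathcal S^2$ hold: $$\mathcal L'[K^{(m)}_{[j]}]-[K^{(m)\prime}_{[j]},\mathcal L]=0\quad (j\in\{0,1\}),$$ $$\mathcal L'[\sigma^{(m)}_{[0]}]-[\sigma^{(m)\prime}_{[0]},\mathcal L]=\mathcal L^m(L-L^{-1}),$$ $$\mathcal L'[\sigma^{(m)}_{[1]}]-[\sigma^{(m)\prime}_{[1]},\mathcal L]=\tfrac12\mathcal L^{m+2}+2\mathcal L^{m+1}.$$ -/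

import Mathlib

noncomputable section

namespace AblowitzLadik

/-- Pairs `(f₁, f₂)ᵀ` of complex sequences on the lattice `ℤ`; the potential is `u = (Q, R)ᵀ`. -/
abbrev Vec : Type := (ℤ → ℂ) × (ℤ → ℂ)

/-- The sequence vanishes rapidly as `|n| → ∞`: faster than every power of `|n|`. -/
def RapidSeq (f : ℤ → ℂ) : Prop :=
  ∀ k : ℕ, ∃ C : ℝ, ∀ n : ℤ, |(n : ℝ)| ^ k * ‖f n‖ ≤ C

/-- Both components vanish rapidly. -/
def Rapid (f : Vec) : Prop := RapidSeq f.1 ∧ RapidSeq f.2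

/-- The operator `(E - 1)⁻¹`, `f ↦ θ ∑_{k < n} f k - (1 - θ) ∑_{k ≥ n} f k`. The weight `θ` covers
the usual normalizations: `θ = 1` (sum from `-∞`), `θ = 0` (sum to `+∞`), `θ = 1/2` (symmetric). -/
def invShift (θ : ℂ) (f : ℤ → ℂ) (n : ℤ) : ℂ :=
  θ * ∑' k : ℕ, f (n - 1 - k) - (1 - θ) * ∑' k : ℕ, f (n + k)

/-- `(E - 1) (E - 1)⁻¹ f = f` for summable `f`. -/
theorem invShift_spec (θ : ℂ) (f : ℤ → ℂ) (hf : Summable f) (n : ℤ) :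
    invShift θ f (n + 1) - invShift θ f n = f n := by
  have h1 : Summable (fun k : ℕ => f (n - k)) :=
    hf.comp_injective (i := fun k : ℕ => n - (k : ℤ)) (fun a b h => by simpa using h)
  have h2 : Summable (fun k : ℕ => f (n + k)) :=
    hf.comp_injective (i := fun k : ℕ => n + (k : ℤ)) (fun a b h => by simpa using h)
  have e1 := h1.tsum_eq_zero_add
  have e2 := h2.tsum_eq_zero_add
  have a1 : ∀ k : ℕ, n + 1 - 1 - (k : ℤ) = n - k := fun k => by ring
  have a2 : ∀ k : ℕ, n - ((k + 1 : ℕ) : ℤ) = n - 1 - k := fun k => by push_cast; ring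
  have a3 : ∀ k : ℕ, n + ((k + 1 : ℕ) : ℤ) = n + 1 + k := fun k => by push_cast; ring
  simp only [a2, a3, Nat.cast_zero, sub_zero, add_zero] at e1 e2
  simp only [invShift, a1]
  rw [e1, e2]
  ring

/-- `γ_n² = 1 - Q_n R_n`. -/
def gammaSq (u : Vec) (n : ℤ) : ℂ := 1 - u.1 n * u.2 n

/-- The recursion operator `L` at the potential `u = (Q, R)`, applied to `h`. -/
def recOp (θ : ℂ) (u h : Vec) : Vec :=
  let Q := u.1
  let R := u.2
  let p : ℤ → ℂ := invShift θ (fun n => R n * h.1 (n + 1) + Q n * h.2 (n - 1))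
  let q : ℤ → ℂ := invShift θ (fun n => (R n * h.1 n + Q n * h.2 n) / gammaSq u n)
  (fun n => h.1 (n + 1) - Q n * p (n + 1) - gammaSq u n * (Q (n + 1) * q (n + 1)),
   fun n => h.2 (n - 1) + R n * p n + gammaSq u n * (R (n - 1) * q n))

/-- The operator `L⁻¹` at the potential `u = (Q, R)`, applied to `h`. -/
def recOpInv (θ : ℂ) (u h : Vec) : Vec :=
  let Q := u.1
  let R := u.2
  let p : ℤ → ℂ := invShift θ (fun n => R n * h.1 (n - 1) + Q n * h.2 (n + 1))
  let q : ℤ → ℂ := invShift θ (fun n => (R n * h.1 n + Q n * h.2 n) / gammaSq u n)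
  (fun n => h.1 (n - 1) + Q n * p n + gammaSq u n * (Q (n - 1) * q n),
   fun n => h.2 (n + 1) - R n * p (n + 1) - gammaSq u n * (R (n + 1) * q (n + 1)))

/-- The operator `𝓛 = L - 2 I + L⁻¹` at the potential `u`, applied to `h`. -/
def calL (θ : ℂ) (u h : Vec) : Vec := recOp θ u h - (2 : ℂ) • h + recOpInv θ u h

/-- `K^{(0)} = (Q_n, -R_n)ᵀ`. -/
def K0 (u : Vec) : Vec := (u.1, -u.2)

/-- `σ^{(0)} = (2n + 1) (Q_n, -R_n)ᵀ`. -/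
def sigma0 (u : Vec) : Vec :=
  (fun n => (2 * (n : ℂ) + 1) * u.1 n, fun n => -((2 * (n : ℂ) + 1) * u.2 n))

/-- The initial flows `K^{(0)}_{[0]} = K^{(0)}` and `K^{(0)}_{[1]} = (1/2) (L - L⁻¹) K^{(0)}`. -/
def Kinit (θ : ℂ) (j : Fin 2) (u : Vec) : Vec :=
  if j = 0 then K0 u else (1 / 2 : ℂ) • (recOp θ u (K0 u) - recOpInv θ u (K0 u))

/-- The initial flows `σ^{(0)}_{[0]} = (1/2) σ^{(0)}` and
`σ^{(0)}_{[1]} = (1/4) (L - L⁻¹) σ^{(0)}`. -/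
def sigmaInit (θ : ℂ) (j : Fin 2) (u : Vec) : Vec :=
  if j = 0 then (1 / 2 : ℂ) • sigma0 u
  else (1 / 4 : ℂ) • (recOp θ u (sigma0 u) - recOpInv θ u (sigma0 u))

/-- The isospectral DAKNS flows `K^{(m)}_{[j]} = 𝓛^m K^{(0)}_{[j]}`. -/
def Kflow (θ : ℂ) (j : Fin 2) (m : ℕ) (u : Vec) : Vec := (calL θ u)^[m] (Kinit θ j u)

/-- The non-isospectral DAKNS flows `σ^{(m)}_{[j]} = 𝓛^m σ^{(0)}_{[j]}`. -/
def sigmaFlow (θ : ℂ) (j : Fin 2) (m : ℕ) (u : Vec) : Vec := (calL θ u)^[m] (sigmaInit θ j u)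

/-- The Gateaux derivative `F'[g] = d/dε F(u + ε g)` at `ε = 0`, `ε ∈ ℝ`, taken at each site. -/
def gateaux (F : Vec → Vec) (u g : Vec) : Vec :=
  (fun n => deriv (fun ε : ℝ => (F (u + (ε : ℂ) • g)).1 n) 0,
   fun n => deriv (fun ε : ℝ => (F (u + (ε : ℂ) • g)).2 n) 0)

/-- The derivative defining `gateaux F u g` exists at each site. -/
def GateauxDiffAt (F : Vec → Vec) (u g : Vec) : Prop :=
  ∀ n : ℤ, DifferentiableAt ℝ (fun ε : ℝ => (F (u + (ε : ℂ) • g)).1 n) 0 ∧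
    DifferentiableAt ℝ (fun ε : ℝ => (F (u + (ε : ℂ) • g)).2 n) 0

/-- The vector field `F` is rapidly vanishing at `u`, and in each rapidly vanishing direction it has
a Gateaux derivative at `u`, which is rapidly vanishing as well. -/
def Regular (F : Vec → Vec) (u : Vec) : Prop :=
  Rapid (F u) ∧ ∀ g, Rapid g → GateauxDiffAt F u g ∧ Rapid (gateaux F u g)

/-- The derivative `Φ'[g]` of a potential-dependent operator `Φ`, as an operator:
`Φ'[g] h = d/dε Φ(u + ε g) h` at `ε = 0`, with `h` fixed. -/
def opGateaux (Φ : Vec → Vec → Vec) (u g : Vec) : Vec → Vec :=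
  fun h => gateaux (fun v => Φ v h) u g

/-- The commutator `[A, B] = A B - B A` of operators. -/
def comm (A B : Vec → Vec) : Vec → Vec := fun h => A (B h) - B (A h)

end AblowitzLadik

end

noncomputable section

namespace AblowitzLadik

open Filter Topology

/-! Everything follows from the Lie derivative of `L` alone. Along a vector field `F` put A = L'[F]
- [F', L]. The operator `L` is hereditary: L(L'[g]h - L'[h]g) = L'[Lg]h - L'[Lh]g
(`recOp_hereditary`). By the Leibniz rule this says exactly that passing from `F` to `LF` replaces A
by LA, and likewise passing from `F` to L⁻¹F replaces A by L⁻¹A (`HasLieDeriv.recOp`,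
`HasLieDeriv.recOpInv`). Hence 𝓛^m F has Lie derivative 𝓛^m A, and only the two seeds have to be
computed: A = 0 for K⁽⁰⁾, a phase symmetry, and A = 2L for σ⁽⁰⁾, a site-dependent phase which
rescales `L`.

Differentiating L L⁻¹ = I gives L⁻¹ the Lie derivative -L⁻¹AL⁻¹, so 𝓛 has A - L⁻¹AL⁻¹
(`opGateaux_sub_comm`). All operators in A commute, and the three identities become algebra: A = 0
gives 0, A = 𝓛^m L gives 𝓛^m(L - L⁻¹), and A = 𝓛^m(L² - I)/2 gives 𝓛^m(L² - 2I + L⁻²)/2 = 𝓛^m(𝓛² +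
4𝓛)/2.

Heredity and the inverse relation involve sums over the lattice. Each is reduced to a rational
identity at one site by telescoping: if f - f' = (E - 1)Y with Y rapidly vanishing, then (E - 1)⁻¹f
= (E - 1)⁻¹f' + Y for every θ (`invShift_of_sub`).

The analytic side rests on expansions a₀ + εa₁ + O(ε²) uniform in the site, in every polynomial
weight. The operator (E - 1)⁻¹ destroys decay, but its output is bounded and is always multiplied by
a rapidly vanishing coefficient, so the expansions survive in the Schwartz space. -/

/-! ### Weighted decay of one-parameter families of sequences. -/

/-- The family `a ε` of sequences is `O(|ε| ^ j)` as `ε → 0` in the weighted supremum norm with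
weight `(1 + |n|) ^ k`. -/
def DecayFamily (k j : ℕ) (a : ℝ → ℤ → ℂ) : Prop :=
  ∃ C : ℝ, ∀ᶠ ε in 𝓝 (0 : ℝ), ∀ n : ℤ, (1 + |(n : ℝ)|) ^ k * ‖a ε n‖ ≤ C * |ε| ^ j

theorem one_le_weight (n : ℤ) : 1 ≤ 1 + |(n : ℝ)| := by
  linarith [abs_nonneg (n : ℝ)]

theorem weight_pos (n : ℤ) (k : ℕ) : 0 < (1 + |(n : ℝ)|) ^ k := by positivity

namespace DecayFamily

variable {k l i j : ℕ} {a b : ℝ → ℤ → ℂ}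

theorem congr' (ha : DecayFamily k j a) (h : ∀ᶠ ε in 𝓝 (0 : ℝ), ∀ n, b ε n = a ε n) :
    DecayFamily k j b := by
  obtain ⟨C, hC⟩ := ha
  refine ⟨C, ?_⟩
  filter_upwards [hC, h] with ε h1 h2 n
  rw [h2 n]
  exact h1 n

theorem congr (ha : DecayFamily k j a) (h : ∀ ε n, b ε n = a ε n) : DecayFamily k j b :=
  ha.congr' (Eventually.of_forall h)

theorem add (ha : DecayFamily k j a) (hb : DecayFamily k j b) :
    DecayFamily k j (fun ε n => a ε n + b ε n) := by
  obtain ⟨C, hC⟩ := ha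
  obtain ⟨D, hD⟩ := hb
  refine ⟨C + D, ?_⟩
  filter_upwards [hC, hD] with ε h1 h2 n
  have := mul_le_mul_of_nonneg_left (norm_add_le (a ε n) (b ε n)) (weight_pos n k).le
  linarith [h1 n, h2 n]

theorem neg (ha : DecayFamily k j a) : DecayFamily k j (fun ε n => -a ε n) := by
  simpa only [DecayFamily, norm_neg] using ha

theorem sub (ha : DecayFamily k j a) (hb : DecayFamily k j b) :
    DecayFamily k j (fun ε n => a ε n - b ε n) :=
  (ha.add hb.neg).congr fun _ _ => sub_eq_add_neg _ _

theorem mul (ha : DecayFamily k i a) (hb : DecayFamily l j b) :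
    DecayFamily (k + l) (i + j) (fun ε n => a ε n * b ε n) := by
  obtain ⟨C, hC⟩ := ha
  obtain ⟨D, hD⟩ := hb
  refine ⟨C * D, ?_⟩
  filter_upwards [hC, hD] with ε h1 h2 n
  have h := mul_le_mul (h1 n) (h2 n) (by positivity)
    ((by positivity : (0 : ℝ) ≤ (1 + |(n : ℝ)|) ^ k * ‖a ε n‖).trans (h1 n))
  rw [norm_mul, pow_add, pow_add]
  linarith

theorem nonneg_const (ha : DecayFamily k j a) : ∃ C : ℝ, 0 ≤ C ∧ ∀ᶠ ε in 𝓝 (0 : ℝ), ∀ n : ℤ,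
    (1 + |(n : ℝ)|) ^ k * ‖a ε n‖ ≤ C * |ε| ^ j := by
  obtain ⟨C, hC⟩ := ha
  refine ⟨|C|, abs_nonneg C, ?_⟩
  filter_upwards [hC] with ε h n
  exact (h n).trans (mul_le_mul_of_nonneg_right (le_abs_self C) (by positivity))

theorem mono_weight (ha : DecayFamily k j a) (h : l ≤ k) : DecayFamily l j a := by
  obtain ⟨C, hC⟩ := ha
  refine ⟨C, ?_⟩
  filter_upwards [hC] with ε h1 n
  exact (mul_le_mul_of_nonneg_right (pow_le_pow_right₀ (one_le_weight n) h)
    (norm_nonneg _)).trans (h1 n)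

theorem mono_order (ha : DecayFamily k j a) (h : i ≤ j) : DecayFamily k i a := by
  obtain ⟨C, hC0, hC⟩ := ha.nonneg_const
  refine ⟨C, ?_⟩
  have h1 : ∀ᶠ ε : ℝ in 𝓝 0, |ε| ≤ 1 := by
    filter_upwards [Metric.ball_mem_nhds (0 : ℝ) one_pos] with ε hε
    simpa using (mem_ball_zero_iff.1 hε).le
  filter_upwards [hC, h1] with ε h2 h3 n
  exact (h2 n).trans (mul_le_mul_of_nonneg_left
    (pow_le_pow_of_le_one (abs_nonneg ε) h3 h) hC0)

theorem shift (ha : DecayFamily k j a) (m : ℤ) : DecayFamily k j (fun ε n => a ε (n + m)) := by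
  obtain ⟨C, hC⟩ := ha
  refine ⟨(1 + |(m : ℝ)|) ^ k * C, ?_⟩
  filter_upwards [hC] with ε h n
  -- Peetre-type inequality: 1 + |n| ≤ (1 + |m|)(1 + |n + m|).
  have h1 : (1 + |(n : ℝ)|) ^ k ≤ (1 + |(m : ℝ)|) ^ k * (1 + |((n + m : ℤ) : ℝ)|) ^ k := by
    rw [← mul_pow]
    refine pow_le_pow_left₀ (by positivity) ?_ k
    have h2 : |(n : ℝ)| ≤ |((n + m : ℤ) : ℝ)| + |(m : ℝ)| := by
      have := abs_sub ((n + m : ℤ) : ℝ) (m : ℝ)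
      push_cast at this ⊢
      simpa using this
    nlinarith [mul_nonneg (abs_nonneg (m : ℝ)) (abs_nonneg ((n + m : ℤ) : ℝ))]
  calc _ ≤ (1 + |(m : ℝ)|) ^ k * (1 + |((n + m : ℤ) : ℝ)|) ^ k * ‖a ε (n + m)‖ :=
        mul_le_mul_of_nonneg_right h1 (norm_nonneg _)
    _ = (1 + |(m : ℝ)|) ^ k * ((1 + |((n + m : ℤ) : ℝ)|) ^ k * ‖a ε (n + m)‖) := by ring
    _ ≤ (1 + |(m : ℝ)|) ^ k * (C * |ε| ^ j) :=
        mul_le_mul_of_nonneg_left (h _) (by positivity)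
    _ = _ := by ring

theorem id_mul (ha : DecayFamily k j a) : DecayFamily k (j + 1) (fun ε n => (ε : ℂ) * a ε n) := by
  obtain ⟨C, hC⟩ := ha
  refine ⟨C, ?_⟩
  filter_upwards [hC] with ε h n
  have := mul_le_mul_of_nonneg_left (h n) (abs_nonneg ε)
  rw [norm_mul, Complex.norm_real, Real.norm_eq_abs, pow_succ]
  linarith

theorem const_mul (ha : DecayFamily k j a) (c : ℂ) : DecayFamily k j (fun ε n => c * a ε n) := by
  obtain ⟨C, hC⟩ := ha
  refine ⟨‖c‖ * C, ?_⟩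
  filter_upwards [hC] with ε h n
  have := mul_le_mul_of_nonneg_left (h n) (norm_nonneg c)
  rw [norm_mul]
  linarith

theorem zero : DecayFamily k j (fun _ _ => 0) :=
  ⟨0, Eventually.of_forall fun ε n => by simp⟩

end DecayFamily

/-! ### Rapidly vanishing and bounded sequences. -/

theorem rapidSeq_iff {f : ℤ → ℂ} : RapidSeq f ↔ ∀ k, DecayFamily k 0 (fun _ => f) := by
  constructor
  · intro h k
    obtain ⟨C, hC⟩ := h k
    obtain ⟨D, hD⟩ := h 0
    refine ⟨2 ^ k * (D + C), Eventually.of_forall fun ε n => ?_⟩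
    have h1 : (1 + |(n : ℝ)|) ^ k ≤ 2 ^ k * (1 + |(n : ℝ)| ^ k) := by
      have := add_pow_le (zero_le_one' ℝ) (abs_nonneg (n : ℝ)) k
      rw [one_pow] at this
      refine this.trans (mul_le_mul_of_nonneg_right ?_ (by positivity))
      exact pow_le_pow_right₀ one_le_two (Nat.sub_le k 1)
    have h2 := hD n
    rw [pow_zero, one_mul] at h2
    calc _ ≤ 2 ^ k * (1 + |(n : ℝ)| ^ k) * ‖f n‖ :=
          mul_le_mul_of_nonneg_right h1 (norm_nonneg _)
      _ = 2 ^ k * (‖f n‖ + |(n : ℝ)| ^ k * ‖f n‖) := by ring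
      _ ≤ 2 ^ k * (D + C) := by gcongr; exact hC n
      _ = _ := by simp
  · intro h k
    obtain ⟨C, hC⟩ := h k
    refine ⟨C, fun n => ?_⟩
    have h1 := hC.self_of_nhds n
    rw [pow_zero, mul_one] at h1
    refine le_trans (mul_le_mul_of_nonneg_right ?_ (norm_nonneg _)) h1
    exact pow_le_pow_left₀ (abs_nonneg _) (by linarith) k

/-- Bounded sequences. -/
def BoundedSeq (f : ℤ → ℂ) : Prop := DecayFamily 0 0 (fun _ => f)

namespace RapidSeq

variable {f g : ℤ → ℂ}

theorem decay (hf : RapidSeq f) (k : ℕ) : DecayFamily k 0 (fun _ => f) := rapidSeq_iff.1 hf k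

theorem congr_fun (hf : RapidSeq f) (h : ∀ n, g n = f n) : RapidSeq g :=
  (funext h : g = f) ▸ hf

theorem bounded (hf : RapidSeq f) : BoundedSeq f := hf.decay 0

theorem add (hf : RapidSeq f) (hg : RapidSeq g) : RapidSeq (fun n => f n + g n) :=
  rapidSeq_iff.2 fun k => (hf.decay k).add (hg.decay k)

theorem sub (hf : RapidSeq f) (hg : RapidSeq g) : RapidSeq (fun n => f n - g n) :=
  rapidSeq_iff.2 fun k => (hf.decay k).sub (hg.decay k)

theorem neg (hf : RapidSeq f) : RapidSeq (fun n => -f n) :=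
  rapidSeq_iff.2 fun k => (hf.decay k).neg

theorem const_mul (hf : RapidSeq f) (c : ℂ) : RapidSeq (fun n => c * f n) :=
  rapidSeq_iff.2 fun k => (hf.decay k).const_mul c

theorem mul_bounded (hf : RapidSeq f) (hg : BoundedSeq g) : RapidSeq (fun n => f n * g n) :=
  rapidSeq_iff.2 fun k => (hf.decay k).mul hg

theorem mul (hf : RapidSeq f) (hg : RapidSeq g) : RapidSeq (fun n => f n * g n) :=
  hf.mul_bounded hg.bounded

theorem shift (hf : RapidSeq f) (m : ℤ) : RapidSeq (fun n => f (n + m)) :=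
  rapidSeq_iff.2 fun k => (hf.decay k).shift m

theorem shift_sub (hf : RapidSeq f) (m : ℤ) : RapidSeq (fun n => f (n - m)) := by
  simpa only [sub_eq_add_neg] using hf.shift (-m)

theorem zero : RapidSeq (fun _ => 0) := fun _ => ⟨0, fun n => by simp⟩

theorem int_mul (hf : RapidSeq f) : RapidSeq (fun n => (n : ℂ) * f n) := by
  intro k
  obtain ⟨C, hC⟩ := hf (k + 1)
  refine ⟨C, fun n => ?_⟩
  have := hC n
  rw [pow_succ] at this
  rw [norm_mul, Complex.norm_intCast, ← mul_assoc]
  exact this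

end RapidSeq

namespace BoundedSeq

variable {f g : ℤ → ℂ}

theorem mul_rapid (hf : BoundedSeq f) (hg : RapidSeq g) : RapidSeq (fun n => f n * g n) := by
  simpa only [mul_comm] using hg.mul_bounded hf

theorem sub (hf : BoundedSeq f) (hg : BoundedSeq g) : BoundedSeq (fun n => f n - g n) :=
  DecayFamily.sub hf hg

theorem shift (hf : BoundedSeq f) (m : ℤ) : BoundedSeq (fun n => f (n + m)) :=
  DecayFamily.shift hf m

theorem shift_sub (hf : BoundedSeq f) (m : ℤ) : BoundedSeq (fun n => f (n - m)) := by
  simpa only [sub_eq_add_neg] using hf.shift (-m)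

theorem one : BoundedSeq (fun _ => 1) := ⟨1, Eventually.of_forall fun ε n => by simp⟩

theorem exists_bound (hf : BoundedSeq f) : ∃ C : ℝ, ∀ n, ‖f n‖ ≤ C := by
  obtain ⟨C, hC⟩ := hf
  exact ⟨C, fun n => by simpa using hC.self_of_nhds n⟩

theorem of_bound {C : ℝ} (h : ∀ n, ‖f n‖ ≤ C) : BoundedSeq f :=
  ⟨C, Eventually.of_forall fun ε n => by simpa using h n⟩

end BoundedSeq

/-! ### Summability and the operator (E - 1)⁻¹. -/

theorem summable_weight : Summable (fun n : ℤ => ((1 + |(n : ℝ)|) ^ 2)⁻¹) := by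
  have h1 : Summable (fun n : ℤ => 1 / (n : ℝ) ^ 2) := Real.summable_one_div_int_pow.2 one_lt_two
  have h2 : Summable (fun n : ℤ => if n = 0 then (1 : ℝ) else 0) :=
    summable_of_ne_finset_zero (s := {0}) fun n hn => by simpa using hn
  refine Summable.of_nonneg_of_le (fun n => by positivity) (fun n => ?_) (h1.add h2)
  by_cases hn : n = 0
  · simp [hn]
  · have : (0 : ℝ) < |(n : ℝ)| := abs_pos.2 (by exact_mod_cast hn)
    simp only [hn, if_false, add_zero, one_div]
    rw [← sq_abs (n : ℝ)]
    gcongr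
    linarith

theorem norm_le_weight_inv {f : ℤ → ℂ} {C : ℝ} (h : ∀ n : ℤ, (1 + |(n : ℝ)|) ^ 2 * ‖f n‖ ≤ C)
    (n : ℤ) : ‖f n‖ ≤ C * ((1 + |(n : ℝ)|) ^ 2)⁻¹ := by
  rw [← div_eq_mul_inv, le_div_iff₀ (weight_pos n 2), mul_comm]
  exact h n

theorem summable_of_weight {f : ℤ → ℂ} {C : ℝ} (h : ∀ n : ℤ, (1 + |(n : ℝ)|) ^ 2 * ‖f n‖ ≤ C) :
    Summable f :=
  Summable.of_norm_bounded (summable_weight.mul_left C) (norm_le_weight_inv h)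

theorem DecayFamily.eventually_summable {j : ℕ} {a : ℝ → ℤ → ℂ} (ha : DecayFamily 2 j a) :
    ∀ᶠ ε in 𝓝 (0 : ℝ), Summable (a ε) := by
  obtain ⟨C, hC⟩ := ha
  filter_upwards [hC] with ε h using summable_of_weight h

theorem RapidSeq.summable {f : ℤ → ℂ} (hf : RapidSeq f) : Summable f :=
  (hf.decay 2).eventually_summable.self_of_nhds

theorem left_injective (n : ℤ) : Function.Injective (fun k : ℕ => n - (k : ℤ)) :=
  fun a b h => by simpa using h

theorem right_injective (n : ℤ) : Function.Injective (fun k : ℕ => n + (k : ℤ)) :=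
  fun a b h => by simpa using h

theorem summable_left {f : ℤ → ℂ} (hf : Summable f) (n : ℤ) :
    Summable (fun k : ℕ => f (n - k)) := hf.comp_injective (left_injective n)

theorem summable_right {f : ℤ → ℂ} (hf : Summable f) (n : ℤ) :
    Summable (fun k : ℕ => f (n + k)) := hf.comp_injective (right_injective n)

theorem invShift_add {f g : ℤ → ℂ} (θ : ℂ) (hf : Summable f) (hg : Summable g) (n : ℤ) :
    invShift θ (fun n => f n + g n) n = invShift θ f n + invShift θ g n := by
  simp only [invShift]
  rw [(summable_left hf (n - 1)).tsum_add (summable_left hg (n - 1)),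
    (summable_right hf n).tsum_add (summable_right hg n)]
  ring

theorem invShift_const_mul (θ c : ℂ) (f : ℤ → ℂ) (n : ℤ) :
    invShift θ (fun n => c * f n) n = c * invShift θ f n := by
  simp only [invShift, tsum_mul_left]
  ring

theorem invShift_neg (θ : ℂ) (f : ℤ → ℂ) (n : ℤ) :
    invShift θ (fun n => -f n) n = -invShift θ f n := by
  simpa using invShift_const_mul θ (-1) f n

theorem invShift_sub {f g : ℤ → ℂ} (θ : ℂ) (hf : Summable f) (hg : Summable g) (n : ℤ) :
    invShift θ (fun n => f n - g n) n = invShift θ f n - invShift θ g n := by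
  simp only [sub_eq_add_neg]
  rw [invShift_add θ hf hg.neg, invShift_neg]

theorem invShift_succ (θ : ℂ) {f : ℤ → ℂ} (hf : RapidSeq f) (n : ℤ) :
    invShift θ f (n + 1) = invShift θ f n + f n := by
  rw [← invShift_spec θ f hf.summable n]
  ring

/-- `(E - 1)⁻¹ (E - 1) Y = Y`. -/
theorem invShift_of_diff (θ : ℂ) {f Y : ℤ → ℂ} (hY : RapidSeq Y)
    (h : ∀ n, f n = Y (n + 1) - Y n) (n : ℤ) : invShift θ f n = Y n := by
  have e1 := (summable_left hY.summable n).tsum_eq_zero_add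
  have e2 := (summable_right hY.summable n).tsum_eq_zero_add
  have a2 : ∀ k : ℕ, n - ((k + 1 : ℕ) : ℤ) = n - 1 - k := fun k => by push_cast; ring
  have a3 : ∀ k : ℕ, n + ((k + 1 : ℕ) : ℤ) = n + k + 1 := fun k => by push_cast; ring
  have a4 : ∀ k : ℕ, n - 1 - (k : ℤ) + 1 = n - k := fun k => by ring
  have s3 : Summable (fun k : ℕ => Y (n + k + 1)) := by
    have := (summable_right hY.summable (n + 1))
    simpa only [add_right_comm] using this
  simp only [a2, a3, Nat.cast_zero, sub_zero, add_zero] at e1 e2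
  simp only [invShift, h, a4]
  rw [(summable_left hY.summable n).tsum_sub (summable_left hY.summable (n - 1)),
    s3.tsum_sub (summable_right hY.summable n), e1, e2]
  ring

/-- Weight 2 suffices because ∑(1 + |n|)⁻² converges. The bound is uniform in the site but carries
no decay: for general θ the sums tend to nonzero constants at infinity. -/
theorem norm_invShift_le (θ : ℂ) {f : ℤ → ℂ} {C : ℝ}
    (h : ∀ n : ℤ, (1 + |(n : ℝ)|) ^ 2 * ‖f n‖ ≤ C) (n : ℤ) :
    ‖invShift θ f n‖ ≤ (‖θ‖ + ‖1 - θ‖) * (C * ∑' n : ℤ, ((1 + |(n : ℝ)|) ^ 2)⁻¹) := by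
  have hs : Summable fun n => ‖f n‖ := (summable_of_weight h).norm
  have hb : ∑' n, ‖f n‖ ≤ C * ∑' n : ℤ, ((1 + |(n : ℝ)|) ^ 2)⁻¹ := by
    rw [← tsum_mul_left]
    exact hs.tsum_le_tsum (norm_le_weight_inv h) (summable_weight.mul_left C)
  have key : ∀ i : ℕ → ℤ, Function.Injective i →
      ‖∑' k, f (i k)‖ ≤ C * ∑' n : ℤ, ((1 + |(n : ℝ)|) ^ 2)⁻¹ := fun i hi =>
    (norm_tsum_le_tsum_norm (hs.comp_injective hi)).trans
      ((tsum_comp_le_tsum_of_inj hs (fun _ => norm_nonneg _) hi).trans hb)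
  have h1 := mul_le_mul_of_nonneg_left (key _ (left_injective (n - 1))) (norm_nonneg θ)
  have h2 := mul_le_mul_of_nonneg_left (key _ (right_injective n)) (norm_nonneg (1 - θ))
  rw [← norm_mul] at h1 h2
  calc _ ≤ _ := norm_sub_le _ _
    _ ≤ _ := add_le_add h1 h2
    _ = _ := by ring

theorem DecayFamily.invShift {j : ℕ} {a : ℝ → ℤ → ℂ} (θ : ℂ) (ha : DecayFamily 2 j a) :
    DecayFamily 0 j (fun ε => invShift θ (a ε)) := by
  obtain ⟨C, hC⟩ := ha
  refine ⟨(‖θ‖ + ‖1 - θ‖) * (C * ∑' n : ℤ, ((1 + |(n : ℝ)|) ^ 2)⁻¹), ?_⟩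
  filter_upwards [hC] with ε h n
  rw [pow_zero, one_mul]
  refine (norm_invShift_le θ h n).trans (le_of_eq ?_)
  ring

theorem RapidSeq.invShift {f : ℤ → ℂ} (θ : ℂ) (hf : RapidSeq f) : BoundedSeq (invShift θ f) :=
  (hf.decay 2).invShift θ

/-! ### First-order expansions of curves of sequences. -/

/-- The curve `a` of sequences has the expansion `a ε = a₀ + ε a₁ + O(ε²)` in the supremum norm with
weight `(1 + |n|) ^ k`. -/
structure Jet (k : ℕ) (a : ℝ → ℤ → ℂ) (a₀ a₁ : ℤ → ℂ) : Prop where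
  zeroth : DecayFamily k 0 (fun _ => a₀)
  first : DecayFamily k 0 (fun _ => a₁)
  rem : DecayFamily k 2 (fun ε n => a ε n - a₀ n - ε * a₁ n)

namespace Jet

variable {k l : ℕ} {a b : ℝ → ℤ → ℂ} {a₀ a₁ b₀ b₁ : ℤ → ℂ}

theorem sub_zeroth (ha : Jet k a a₀ a₁) : DecayFamily k 1 (fun ε n => a ε n - a₀ n) :=
  ((ha.rem.mono_order one_le_two).add (ha.first.id_mul)).congr fun ε n => by ring

theorem decay (ha : Jet k a a₀ a₁) : DecayFamily k 0 a :=
  ((ha.sub_zeroth.mono_order zero_le_one).add ha.zeroth).congr fun ε n => by ring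

theorem congr (ha : Jet k a a₀ a₁) (h : ∀ᶠ ε in 𝓝 (0 : ℝ), ∀ n, b ε n = a ε n)
    (h₀ : ∀ n, b₀ n = a₀ n) (h₁ : ∀ n, b₁ n = a₁ n) : Jet k b b₀ b₁ := by
  obtain rfl : b₀ = a₀ := funext h₀
  obtain rfl : b₁ = a₁ := funext h₁
  refine ⟨ha.zeroth, ha.first, ha.rem.congr' ?_⟩
  filter_upwards [h] with ε hε n
  rw [hε n]

theorem mono (ha : Jet k a a₀ a₁) (h : l ≤ k) : Jet l a a₀ a₁ :=
  ⟨ha.zeroth.mono_weight h, ha.first.mono_weight h, ha.rem.mono_weight h⟩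

theorem add (ha : Jet k a a₀ a₁) (hb : Jet k b b₀ b₁) :
    Jet k (fun ε n => a ε n + b ε n) (fun n => a₀ n + b₀ n) (fun n => a₁ n + b₁ n) :=
  ⟨ha.zeroth.add hb.zeroth, ha.first.add hb.first,
    (ha.rem.add hb.rem).congr fun ε n => by ring⟩

theorem sub (ha : Jet k a a₀ a₁) (hb : Jet k b b₀ b₁) :
    Jet k (fun ε n => a ε n - b ε n) (fun n => a₀ n - b₀ n) (fun n => a₁ n - b₁ n) :=
  ⟨ha.zeroth.sub hb.zeroth, ha.first.sub hb.first,
    (ha.rem.sub hb.rem).congr fun ε n => by ring⟩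

theorem const_mul (ha : Jet k a a₀ a₁) (c : ℂ) :
    Jet k (fun ε n => c * a ε n) (fun n => c * a₀ n) (fun n => c * a₁ n) :=
  ⟨ha.zeroth.const_mul c, ha.first.const_mul c, (ha.rem.const_mul c).congr fun ε n => by ring⟩

theorem mul (ha : Jet k a a₀ a₁) (hb : Jet l b b₀ b₁) :
    Jet (k + l) (fun ε n => a ε n * b ε n) (fun n => a₀ n * b₀ n)
      (fun n => a₀ n * b₁ n + a₁ n * b₀ n) :=
  ⟨ha.zeroth.mul hb.zeroth, (ha.zeroth.mul hb.first).add (ha.first.mul hb.zeroth),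
    -- The remainder of ab is rem(a)·b + a₀·rem(b) + εa₁(b - b₀); the last term is a product of two
    -- factors of order ε.
    (((ha.rem.mul hb.decay).add (ha.zeroth.mul hb.rem)).add
      (ha.first.id_mul.mul hb.sub_zeroth)).congr fun ε n => by ring⟩

theorem shift (ha : Jet k a a₀ a₁) (m : ℤ) :
    Jet k (fun ε n => a ε (n + m)) (fun n => a₀ (n + m)) (fun n => a₁ (n + m)) :=
  ⟨ha.zeroth.shift m, ha.first.shift m, ha.rem.shift m⟩

theorem shift_sub (ha : Jet k a a₀ a₁) (m : ℤ) :
    Jet k (fun ε n => a ε (n - m)) (fun n => a₀ (n - m)) (fun n => a₁ (n - m)) := by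
  simpa only [sub_eq_add_neg] using ha.shift (-m)

theorem const (ha : DecayFamily k 0 (fun _ => a₀)) :
    Jet k (fun _ => a₀) a₀ (fun _ => 0) :=
  ⟨ha, DecayFamily.zero, DecayFamily.zero.congr fun ε n => by ring⟩

theorem affine (h₀ : DecayFamily k 0 (fun _ => a₀)) (h₁ : DecayFamily k 0 (fun _ => a₁)) :
    Jet k (fun ε n => a₀ n + ε * a₁ n) a₀ a₁ :=
  ⟨h₀, h₁, DecayFamily.zero.congr fun ε n => by ring⟩

theorem invShift (θ : ℂ) (ha : Jet 2 a a₀ a₁) :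
    Jet 0 (fun ε => invShift θ (a ε)) (invShift θ a₀) (invShift θ a₁) := by
  refine ⟨ha.zeroth.invShift θ, ha.first.invShift θ, (ha.rem.invShift θ).congr' ?_⟩
  have h0 := ha.zeroth.eventually_summable.self_of_nhds
  have h1 := ha.first.eventually_summable.self_of_nhds
  filter_upwards [ha.decay.eventually_summable] with ε hε n
  rw [invShift_sub θ (hε.sub h0) (h1.mul_left _), invShift_sub θ hε h0, invShift_const_mul]

theorem eventually_norm_inv_le (ha : Jet 0 a a₀ a₁) (h₀ : BoundedSeq (fun n => (a₀ n)⁻¹))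
    (hne : ∀ n, a₀ n ≠ 0) :
    ∃ C : ℝ, ∀ᶠ ε in 𝓝 (0 : ℝ), ∀ n, a ε n ≠ 0 ∧ ‖(a ε n)⁻¹‖ ≤ C := by
  obtain ⟨D, hD⟩ := h₀.exists_bound
  obtain ⟨C, hC0, hC⟩ := ha.sub_zeroth.nonneg_const
  have hDpos : 0 < D := (norm_pos_iff.2 (inv_ne_zero (hne 0))).trans_le (hD 0)
  -- Since |a₀| ≥ 1/D at every site, a perturbation below 1/(2D) leaves |a| ≥ 1/(2D) at all sites at
  -- once.
  have hsmall : ∀ᶠ ε : ℝ in 𝓝 0, C * |ε| < D⁻¹ / 2 := by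
    have : Tendsto (fun ε : ℝ => C * |ε|) (𝓝 0) (𝓝 (C * |(0 : ℝ)|)) :=
      (continuous_const.mul continuous_abs).tendsto 0
    rw [abs_zero, mul_zero] at this
    exact this.eventually_lt_const (by positivity)
  refine ⟨2 * D, ?_⟩
  filter_upwards [hC, hsmall] with ε h1 h2 n
  have h3 := h1 n
  rw [pow_zero, one_mul, pow_one] at h3
  have h4 : D⁻¹ ≤ ‖a₀ n‖ := by
    have := hD n
    rw [norm_inv] at this
    exact inv_le_of_inv_le₀ (norm_pos_iff.2 (hne n)) this
  have h5 : ‖a₀ n‖ ≤ ‖a ε n‖ + ‖a ε n - a₀ n‖ := by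
    have := norm_sub_le (a ε n) (a ε n - a₀ n)
    simpa using this
  have h6 : D⁻¹ / 2 ≤ ‖a ε n‖ := by linarith
  have h7 : 0 < ‖a ε n‖ := lt_of_lt_of_le (by positivity) h6
  refine ⟨norm_pos_iff.1 h7, ?_⟩
  rw [norm_inv]
  refine inv_le_of_inv_le₀ (by positivity) ?_
  rw [mul_inv, mul_comm, ← div_eq_mul_inv]
  exact h6

theorem inv (ha : Jet 0 a a₀ a₁) (h₀ : BoundedSeq (fun n => (a₀ n)⁻¹)) (hne : ∀ n, a₀ n ≠ 0) :
    Jet 0 (fun ε n => (a ε n)⁻¹) (fun n => (a₀ n)⁻¹)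
      (fun n => -(a₁ n * ((a₀ n)⁻¹ * (a₀ n)⁻¹))) := by
  obtain ⟨C, hC⟩ := ha.eventually_norm_inv_le h₀ hne
  have hinv : DecayFamily 0 0 (fun ε n => (a ε n)⁻¹) := by
    refine ⟨C, ?_⟩
    filter_upwards [hC] with ε h n
    simpa using (h n).2
  have hsq : DecayFamily 0 0 (fun _ n => (a₀ n)⁻¹ * (a₀ n)⁻¹) := DecayFamily.mul h₀ h₀
  refine ⟨h₀, (DecayFamily.mul ha.first hsq).neg, ?_⟩
  -- Over the common denominator a·a₀², the remainder of 1/a has numerator εa₁(a - a₀) - rem(a)·a₀.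
  have key := ((ha.first.id_mul.mul ha.sub_zeroth).sub (ha.rem.mul ha.zeroth)).mul (hinv.mul hsq)
  refine key.congr' ?_
  filter_upwards [hC] with ε h n
  have h1 := (h n).1
  have h2 := hne n
  field_simp
  ring

/-- The bound C|ε|² on the remainder vanishes at ε = 0, which belongs to the neighbourhood. -/
theorem apply_zero (ha : Jet k a a₀ a₁) (n : ℤ) : a 0 n = a₀ n := by
  obtain ⟨C, hC⟩ := (ha.mono (Nat.zero_le k)).rem
  have := hC.self_of_nhds n
  simpa [sub_eq_zero] using this

theorem hasDerivAt (ha : Jet k a a₀ a₁) (n : ℤ) : HasDerivAt (fun ε => a ε n) (a₁ n) 0 := by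
  obtain ⟨C, hC⟩ := (ha.mono (Nat.zero_le k)).rem
  rw [hasDerivAt_iff_isLittleO]
  have hO : (fun ε : ℝ => a ε n - a 0 n - (ε - 0) • a₁ n) =O[𝓝 0] fun ε : ℝ => ε ^ 2 := by
    refine Asymptotics.IsBigO.of_bound C ?_
    filter_upwards [hC] with ε h
    have := h n
    rw [ha.apply_zero n]
    simpa using this
  refine hO.trans_isLittleO ?_
  simpa using Asymptotics.isLittleO_pow_id (𝕜 := ℝ) one_lt_two

end Jet

/-- The expansion `a ε = a₀ + ε a₁ + O(ε²)` holds with every polynomial weight. -/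
def RapidJet (a : ℝ → ℤ → ℂ) (a₀ a₁ : ℤ → ℂ) : Prop := ∀ k, Jet k a a₀ a₁

namespace RapidJet

variable {a b : ℝ → ℤ → ℂ} {a₀ a₁ b₀ b₁ : ℤ → ℂ}

theorem zeroth (ha : RapidJet a a₀ a₁) : RapidSeq a₀ := rapidSeq_iff.2 fun k => (ha k).zeroth

theorem first (ha : RapidJet a a₀ a₁) : RapidSeq a₁ := rapidSeq_iff.2 fun k => (ha k).first

theorem affine (h₀ : RapidSeq a₀) (h₁ : RapidSeq a₁) :
    RapidJet (fun ε n => a₀ n + ε * a₁ n) a₀ a₁ :=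
  fun k => Jet.affine (h₀.decay k) (h₁.decay k)

theorem const (h₀ : RapidSeq a₀) : RapidJet (fun _ => a₀) a₀ (fun _ => 0) :=
  fun k => Jet.const (h₀.decay k)

theorem congr (ha : RapidJet a a₀ a₁) (h : ∀ ε n, b ε n = a ε n)
    (h₀ : ∀ n, b₀ n = a₀ n) (h₁ : ∀ n, b₁ n = a₁ n) : RapidJet b b₀ b₁ :=
  fun k => (ha k).congr (Eventually.of_forall h) h₀ h₁

theorem add (ha : RapidJet a a₀ a₁) (hb : RapidJet b b₀ b₁) :
    RapidJet (fun ε n => a ε n + b ε n) (fun n => a₀ n + b₀ n) (fun n => a₁ n + b₁ n) :=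
  fun k => (ha k).add (hb k)

theorem sub (ha : RapidJet a a₀ a₁) (hb : RapidJet b b₀ b₁) :
    RapidJet (fun ε n => a ε n - b ε n) (fun n => a₀ n - b₀ n) (fun n => a₁ n - b₁ n) :=
  fun k => (ha k).sub (hb k)

theorem const_mul (ha : RapidJet a a₀ a₁) (c : ℂ) :
    RapidJet (fun ε n => c * a ε n) (fun n => c * a₀ n) (fun n => c * a₁ n) :=
  fun k => (ha k).const_mul c

/-- Decay of one factor is enough. This lets the merely bounded nonlocal terms and 1/γ² enter
expansions in the Schwartz space. -/
theorem mul_jet (ha : RapidJet a a₀ a₁) (hb : Jet 0 b b₀ b₁) :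
    RapidJet (fun ε n => a ε n * b ε n) (fun n => a₀ n * b₀ n)
      (fun n => a₀ n * b₁ n + a₁ n * b₀ n) :=
  fun k => (ha k).mul hb

theorem mul (ha : RapidJet a a₀ a₁) (hb : RapidJet b b₀ b₁) :
    RapidJet (fun ε n => a ε n * b ε n) (fun n => a₀ n * b₀ n)
      (fun n => a₀ n * b₁ n + a₁ n * b₀ n) :=
  ha.mul_jet (hb 0)

theorem shift (ha : RapidJet a a₀ a₁) (m : ℤ) :
    RapidJet (fun ε n => a ε (n + m)) (fun n => a₀ (n + m)) (fun n => a₁ (n + m)) :=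
  fun k => (ha k).shift m

theorem shift_sub (ha : RapidJet a a₀ a₁) (m : ℤ) :
    RapidJet (fun ε n => a ε (n - m)) (fun n => a₀ (n - m)) (fun n => a₁ (n - m)) :=
  fun k => (ha k).shift_sub m

theorem invShift (θ : ℂ) (ha : RapidJet a a₀ a₁) :
    Jet 0 (fun ε => AblowitzLadik.invShift θ (a ε)) (AblowitzLadik.invShift θ a₀)
      (AblowitzLadik.invShift θ a₁) :=
  (ha 2).invShift θ

end RapidJet

/-! ### The nonlocal terms of `L` and their derivatives. -/

/-- The summand of the first nonlocal term of `recOp`. -/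
def pSrc (u h : Vec) (n : ℤ) : ℂ := u.2 n * h.1 (n + 1) + u.1 n * h.2 (n - 1)

/-- The summand of the second nonlocal term of `recOp`. -/
def qSrc (u h : Vec) (n : ℤ) : ℂ := (u.2 n * h.1 n + u.1 n * h.2 n) / gammaSq u n

/-- The derivative of `qSrc · h` at `u` in the direction `g`. -/
def dqSrc (u g h : Vec) (n : ℤ) : ℂ :=
  (g.2 n * h.1 n + g.1 n * h.2 n) / gammaSq u n + qSrc u g n * qSrc u h n

/-- The derivative of `gammaSq` at `u` in the direction `g`. -/
def dGammaSq (u g : Vec) (n : ℤ) : ℂ := -(u.2 n * g.1 n + u.1 n * g.2 n)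

/-- The first nonlocal term of `recOp`. -/
def pInt (θ : ℂ) (u h : Vec) : ℤ → ℂ := invShift θ (pSrc u h)

/-- The second nonlocal term of `recOp`. -/
def qInt (θ : ℂ) (u h : Vec) : ℤ → ℂ := invShift θ (qSrc u h)

/-- The derivative of `qInt θ · h` at `u` in the direction `g`. -/
def dqInt (θ : ℂ) (u g h : Vec) : ℤ → ℂ := invShift θ (dqSrc u g h)

theorem recOp_fst (θ : ℂ) (u h : Vec) (n : ℤ) : (recOp θ u h).1 n =
    h.1 (n + 1) - u.1 n * pInt θ u h (n + 1)
      - gammaSq u n * (u.1 (n + 1) * qInt θ u h (n + 1)) := rfl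

theorem recOp_snd (θ : ℂ) (u h : Vec) (n : ℤ) : (recOp θ u h).2 n =
    h.2 (n - 1) + u.2 n * pInt θ u h n + gammaSq u n * (u.2 (n - 1) * qInt θ u h n) := rfl

/-- The derivative of `recOp θ · h` at `u` in the direction `g`. -/
def dRecOp (θ : ℂ) (u g h : Vec) : Vec :=
  (fun n => -(g.1 n * pInt θ u h (n + 1) + u.1 n * pInt θ g h (n + 1)
      + dGammaSq u g n * (u.1 (n + 1) * qInt θ u h (n + 1))
      + gammaSq u n * (g.1 (n + 1) * qInt θ u h (n + 1) + u.1 (n + 1) * dqInt θ u g h (n + 1))),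
   fun n => g.2 n * pInt θ u h n + u.2 n * pInt θ g h n
      + dGammaSq u g n * (u.2 (n - 1) * qInt θ u h n)
      + gammaSq u n * (g.2 (n - 1) * qInt θ u h n + u.2 (n - 1) * dqInt θ u g h n))

/-- Potentials in the Schwartz space with `γ_n ≠ 0` for all `n`. -/
structure Admissible (u : Vec) : Prop where
  rapid : Rapid u
  ne_zero : ∀ n, gammaSq u n ≠ 0

namespace Admissible

variable {u : Vec}

theorem bounded_gammaSq (hu : Admissible u) : BoundedSeq (gammaSq u) :=
  BoundedSeq.one.sub (hu.rapid.1.mul hu.rapid.2).bounded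

/-- γ_n² tends to 1 at infinity, so 1/γ² converges along the cofinite filter and has bounded range;
pointwise nonvanishing thus becomes a uniform bound. -/
theorem bounded_inv (hu : Admissible u) : BoundedSeq (fun n => (gammaSq u n)⁻¹) := by
  have h1 : Tendsto (fun n => u.1 n * u.2 n) cofinite (𝓝 0) :=
    (hu.rapid.1.mul hu.rapid.2).summable.tendsto_cofinite_zero
  have h2 : Tendsto (fun n => ‖(gammaSq u n)⁻¹‖) cofinite (𝓝 ‖(1 - 0 : ℂ)⁻¹‖) :=
    ((h1.const_sub 1).inv₀ (by simp)).norm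
  obtain ⟨C, hC⟩ := h2.bddAbove_range_of_cofinite
  exact BoundedSeq.of_bound fun n => hC ⟨n, rfl⟩

end Admissible

theorem Rapid.pSrc {u h : Vec} (hu : Rapid u) (hh : Rapid h) : RapidSeq (pSrc u h) :=
  (hu.2.mul (hh.1.shift 1)).add (hu.1.mul (hh.2.shift_sub 1))

theorem Admissible.qSrc {u h : Vec} (hu : Admissible u) (hh : Rapid h) : RapidSeq (qSrc u h) := by
  have := ((hu.rapid.2.mul hh.1).add (hu.rapid.1.mul hh.2)).mul_bounded hu.bounded_inv
  simp only [← div_eq_mul_inv] at this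
  exact this

theorem Admissible.dqSrc {u g h : Vec} (hu : Admissible u) (hg : Rapid g) (hh : Rapid h) :
    RapidSeq (dqSrc u g h) := by
  have := ((hg.2.mul hh.1).add (hg.1.mul hh.2)).mul_bounded hu.bounded_inv
  simp only [← div_eq_mul_inv] at this
  exact this.add ((hu.qSrc hg).mul (hu.qSrc hh))

theorem Rapid.pInt {u h : Vec} (θ : ℂ) (hu : Rapid u) (hh : Rapid h) : BoundedSeq (pInt θ u h) :=
  (hu.pSrc hh).invShift θ

theorem Admissible.qInt {u h : Vec} (θ : ℂ) (hu : Admissible u) (hh : Rapid h) :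
    BoundedSeq (qInt θ u h) :=
  (hu.qSrc hh).invShift θ

namespace Rapid

variable {f g : Vec}

theorem add (hf : Rapid f) (hg : Rapid g) : Rapid (f + g) := ⟨hf.1.add hg.1, hf.2.add hg.2⟩

theorem sub (hf : Rapid f) (hg : Rapid g) : Rapid (f - g) := ⟨hf.1.sub hg.1, hf.2.sub hg.2⟩

theorem smul (hf : Rapid f) (c : ℂ) : Rapid (c • f) := ⟨hf.1.const_mul c, hf.2.const_mul c⟩

theorem zero : Rapid 0 := ⟨RapidSeq.zero, RapidSeq.zero⟩

theorem swap (hf : Rapid f) : Rapid f.swap := ⟨hf.2, hf.1⟩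

end Rapid

theorem Rapid.recOp {u h : Vec} (θ : ℂ) (hu : Admissible u) (hh : Rapid h) :
    Rapid (recOp θ u h) :=
  ⟨((hh.1.shift 1).sub (hu.rapid.1.mul_bounded ((hu.rapid.pInt θ hh).shift 1))).sub
      (hu.bounded_gammaSq.mul_rapid
        ((hu.rapid.1.shift 1).mul_bounded ((hu.qInt θ hh).shift 1))),
    ((hh.2.shift_sub 1).add (hu.rapid.2.mul_bounded (hu.rapid.pInt θ hh))).add
      (hu.bounded_gammaSq.mul_rapid ((hu.rapid.2.shift_sub 1).mul_bounded (hu.qInt θ hh)))⟩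

/-! ### Curves in the Schwartz space and the Leibniz rule for `L`. -/

/-- The expansion `F ε = F₀ + ε F₁ + O(ε²)` of a curve in the Schwartz space. -/
def VecJet (F : ℝ → Vec) (F₀ F₁ : Vec) : Prop :=
  RapidJet (fun ε => (F ε).1) F₀.1 F₁.1 ∧ RapidJet (fun ε => (F ε).2) F₀.2 F₁.2

namespace VecJet

variable {F H : ℝ → Vec} {F₀ F₁ H₀ H₁ : Vec}

theorem zeroth (hF : VecJet F F₀ F₁) : Rapid F₀ := ⟨hF.1.zeroth, hF.2.zeroth⟩

theorem first (hF : VecJet F F₀ F₁) : Rapid F₁ := ⟨hF.1.first, hF.2.first⟩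

theorem const (h : Rapid F₀) : VecJet (fun _ => F₀) F₀ 0 :=
  ⟨RapidJet.const h.1, RapidJet.const h.2⟩

theorem line (h₀ : Rapid F₀) (h₁ : Rapid F₁) : VecJet (fun ε => F₀ + (ε : ℂ) • F₁) F₀ F₁ :=
  ⟨RapidJet.affine h₀.1 h₁.1, RapidJet.affine h₀.2 h₁.2⟩

theorem add (hF : VecJet F F₀ F₁) (hH : VecJet H H₀ H₁) :
    VecJet (fun ε => F ε + H ε) (F₀ + H₀) (F₁ + H₁) :=
  ⟨hF.1.add hH.1, hF.2.add hH.2⟩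

theorem sub (hF : VecJet F F₀ F₁) (hH : VecJet H H₀ H₁) :
    VecJet (fun ε => F ε - H ε) (F₀ - H₀) (F₁ - H₁) :=
  ⟨hF.1.sub hH.1, hF.2.sub hH.2⟩

theorem smul (hF : VecJet F F₀ F₁) (c : ℂ) : VecJet (fun ε => c • F ε) (c • F₀) (c • F₁) :=
  ⟨hF.1.const_mul c, hF.2.const_mul c⟩

theorem swap (hF : VecJet F F₀ F₁) : VecJet (fun ε => (F ε).swap) F₀.swap F₁.swap :=
  ⟨hF.2, hF.1⟩

theorem unique (hF : VecJet F F₀ F₁) (hH : VecJet F H₀ H₁) : F₁ = H₁ :=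
  Prod.ext (funext fun n => ((hF.1 0).hasDerivAt n).unique ((hH.1 0).hasDerivAt n))
    (funext fun n => ((hF.2 0).hasDerivAt n).unique ((hH.2 0).hasDerivAt n))

end VecJet

section

variable {v H : ℝ → Vec} {u g h h' : Vec}

theorem VecJet.pSrc (hv : VecJet v u g) (hH : VecJet H h h') :
    RapidJet (fun ε => pSrc (v ε) (H ε)) (pSrc u h)
      (fun n => AblowitzLadik.pSrc g h n + AblowitzLadik.pSrc u h' n) :=
  ((hv.2.mul (hH.1.shift 1)).add (hv.1.mul (hH.2.shift_sub 1))).congr (fun _ _ => rfl)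
    (fun _ => rfl) fun n => by simp only [AblowitzLadik.pSrc]; ring

theorem VecJet.gammaSq (hv : VecJet v u g) :
    Jet 0 (fun ε => gammaSq (v ε)) (gammaSq u) (dGammaSq u g) :=
  ((Jet.const BoundedSeq.one).sub ((hv.1.mul hv.2) 0)).congr
    (Eventually.of_forall fun _ _ => rfl) (fun _ => rfl)
    fun n => by simp only [dGammaSq]; ring

theorem VecJet.qSrc (hu : Admissible u) (hv : VecJet v u g) (hH : VecJet H h h') :
    RapidJet (fun ε => qSrc (v ε) (H ε)) (qSrc u h)
      (fun n => dqSrc u g h n + AblowitzLadik.qSrc u h' n) :=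
  (((hv.2.mul hH.1).add (hv.1.mul hH.2)).mul_jet
    (hv.gammaSq.inv hu.bounded_inv hu.ne_zero)).congr (fun _ _ => div_eq_mul_inv _ _)
    (fun _ => div_eq_mul_inv _ _) fun n => by
      simp only [dqSrc, AblowitzLadik.qSrc, dGammaSq, div_eq_mul_inv]; ring

theorem VecJet.pInt (θ : ℂ) (hv : VecJet v u g) (hH : VecJet H h h') :
    Jet 0 (fun ε => pInt θ (v ε) (H ε)) (pInt θ u h)
      (fun n => AblowitzLadik.pInt θ g h n + AblowitzLadik.pInt θ u h' n) :=
  ((hv.pSrc hH).invShift θ).congr (Eventually.of_forall fun _ _ => rfl) (fun _ => rfl) fun n =>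
    (invShift_add θ (hv.first.pSrc hH.zeroth).summable (hv.zeroth.pSrc hH.first).summable n).symm

theorem VecJet.qInt (θ : ℂ) (hu : Admissible u) (hv : VecJet v u g) (hH : VecJet H h h') :
    Jet 0 (fun ε => qInt θ (v ε) (H ε)) (qInt θ u h)
      (fun n => dqInt θ u g h n + AblowitzLadik.qInt θ u h' n) :=
  ((hv.qSrc hu hH).invShift θ).congr (Eventually.of_forall fun _ _ => rfl) (fun _ => rfl) fun n =>
    (invShift_add θ (hu.dqSrc hv.first hH.zeroth).summable (hu.qSrc hH.first).summable n).symm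

/-- The Leibniz rule for `recOp` along a curve of potentials and a curve of arguments. -/
theorem VecJet.recOp (θ : ℂ) (hu : Admissible u) (hv : VecJet v u g) (hH : VecJet H h h') :
    VecJet (fun ε => recOp θ (v ε) (H ε)) (recOp θ u h)
      (dRecOp θ u g h + recOp θ u h') := by
  have hp := hv.pInt θ hH
  have hq := hv.qInt θ hu hH
  have hG := hv.gammaSq
  constructor
  · refine (((hH.1.shift 1).sub (hv.1.mul_jet (hp.shift 1))).sub
      (((hv.1.shift 1).mul_jet (hq.shift 1)).mul_jet hG)).congr (fun ε n => ?_) (fun n => ?_)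
      fun n => ?_
    · rw [recOp_fst]; ring
    · rw [recOp_fst]; ring
    · simp only [dRecOp, Prod.fst_add, Pi.add_apply, recOp_fst]; ring
  · refine (((hH.2.shift_sub 1).add (hv.2.mul_jet hp)).add
      (((hv.2.shift_sub 1).mul_jet hq).mul_jet hG)).congr (fun ε n => ?_) (fun n => ?_)
      fun n => ?_
    · rw [recOp_snd]; ring
    · rw [recOp_snd]; ring
    · simp only [dRecOp, Prod.snd_add, Pi.add_apply, recOp_snd]; ring

theorem Admissible.dRecOp (θ : ℂ) (hu : Admissible u) (hg : Rapid g) (hh : Rapid h) :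
    Rapid (dRecOp θ u g h) := by
  -- With a constant argument the Leibniz rule has derivative `dRecOp` plus `L` applied to 0; both
  -- the sum and the second term are rapidly vanishing.
  have h1 := ((VecJet.line hu.rapid hg).recOp θ hu (VecJet.const hh)).first
  have h2 := h1.sub (Rapid.recOp θ hu Rapid.zero)
  rwa [add_sub_cancel_right] at h2

end

/-! ### L and L⁻¹ are mutually inverse. -/

/-- Exchanging Q with R and the two components exchanges E with E⁻¹ and fixes γ². Every fact about
`L` therefore transfers to L⁻¹. -/
theorem recOpInv_eq_swap (θ : ℂ) (u h : Vec) :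
    recOpInv θ u h = (recOp θ u.swap h.swap).swap := by
  have h1 : gammaSq u.swap = gammaSq u := funext fun n => by simp [gammaSq, mul_comm]
  simp only [recOpInv, recOp, h1, Prod.fst_swap, Prod.snd_swap, Prod.swap_prod_mk, add_comm]

theorem Admissible.swap {u : Vec} (hu : Admissible u) : Admissible u.swap :=
  ⟨hu.rapid.swap, fun n => by simpa [gammaSq, mul_comm] using hu.ne_zero n⟩

/-- Y decays at both ends, so telescoping leaves no boundary term and the value of θ does not
matter. All nonlocal identities below come from a suitable choice of Y. -/
theorem invShift_of_sub (θ : ℂ) {f f' Y : ℤ → ℂ} (hf : RapidSeq f) (hf' : RapidSeq f')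
    (hY : RapidSeq Y) (h : ∀ n, f n - f' n = Y (n + 1) - Y n) (n : ℤ) :
    invShift θ f n = invShift θ f' n + Y n := by
  have := invShift_of_diff θ hY h n
  rw [invShift_sub θ hf.summable hf'.summable] at this
  linear_combination this

section

variable {u g h : Vec} (θ : ℂ)

theorem pInt_succ (hu : Rapid u) (hh : Rapid h) (n : ℤ) :
    pInt θ u h (n + 1) = pInt θ u h n + (u.2 n * h.1 (n + 1) + u.1 n * h.2 (n - 1)) :=
  invShift_succ θ (hu.pSrc hh) n

theorem qInt_succ (hu : Admissible u) (hh : Rapid h) (n : ℤ) :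
    qInt θ u h (n + 1) = qInt θ u h n + (u.2 n * h.1 n + u.1 n * h.2 n) / gammaSq u n :=
  invShift_succ θ (hu.qSrc hh) n

theorem qInt_pred (hu : Admissible u) (hh : Rapid h) (n : ℤ) :
    qInt θ u h (n - 1) = qInt θ u h n
      - (u.2 (n - 1) * h.1 (n - 1) + u.1 (n - 1) * h.2 (n - 1)) / gammaSq u (n - 1) := by
  have := qInt_succ θ hu hh (n - 1)
  rw [sub_add_cancel] at this
  rw [this]
  ring

theorem pInt_pred (hu : Rapid u) (hh : Rapid h) (n : ℤ) :
    pInt θ u h (n - 1) = pInt θ u h n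
      - (u.2 (n - 1) * h.1 n + u.1 (n - 1) * h.2 (n - 1 - 1)) := by
  have := pInt_succ θ hu hh (n - 1)
  rw [sub_add_cancel] at this
  rw [this]
  ring

/-- With `pInt_swap_recOp`, this expresses the nonlocal terms of L⁻¹ at `Lh` through those of `L` at
`h`, after which L⁻¹L = I is checked site by site. -/
theorem qInt_recOp (hu : Admissible u) (hh : Rapid h) (n : ℤ) :
    qInt θ u (recOp θ u h) n = pInt θ u h n - u.1 n * u.2 (n - 1) * qInt θ u h n := by
  rw [sub_eq_add_neg]
  refine invShift_of_sub θ (hu.qSrc (hh.recOp θ hu)) (hu.rapid.pSrc hh)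
    (((hu.rapid.1.mul (hu.rapid.2.shift_sub 1)).mul_bounded (hu.qInt θ hh)).neg) (fun m => ?_) n
  simp only [qSrc, pSrc, recOp_fst, recOp_snd, add_sub_cancel_right, pInt_succ θ hu.rapid hh,
    qInt_succ θ hu hh]
  -- γ² stays opaque while denominators are cleared; only then is it expanded as 1 - QR.
  have h0 := hu.ne_zero m
  field_simp
  simp only [gammaSq]
  ring

theorem pInt_swap_recOp (hu : Admissible u) (hh : Rapid h) (n : ℤ) :
    pInt θ u.swap (recOp θ u h).swap n = qInt θ u h n
      + (u.1 (n - 1) * u.2 n * pInt θ u h n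
        - u.1 (n - 1) * u.2 (n - 1) * (u.1 n * u.2 n) * qInt θ u h n) := by
  have hR := hu.rapid
  refine invShift_of_sub θ (hR.swap.pSrc (hh.recOp θ hu).swap) (hu.qSrc hh)
    (RapidSeq.sub (((hR.1.shift_sub 1).mul hR.2).mul_bounded (hR.pInt θ hh))
      ((((hR.1.shift_sub 1).mul (hR.2.shift_sub 1)).mul (hR.1.mul hR.2)).mul_bounded
        (hu.qInt θ hh))) (fun m => ?_) n
  simp only [qSrc, pSrc, recOp_fst, recOp_snd, add_sub_cancel_right, sub_add_cancel,
    pInt_succ θ hR hh, qInt_succ θ hu hh, Prod.fst_swap, Prod.snd_swap]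
  have h0 := hu.ne_zero m
  field_simp
  simp only [gammaSq]
  ring

theorem recOpInv_recOp (hu : Admissible u) (hh : Rapid h) :
    recOpInv θ u (recOp θ u h) = h := by
  have h1 : gammaSq u.swap = gammaSq u := funext fun n => by simp [gammaSq, mul_comm]
  have h2 : qInt θ u.swap (recOp θ u h).swap = qInt θ u (recOp θ u h) := by
    refine congrArg (invShift θ) (funext fun n => ?_)
    simp only [qSrc, h1, Prod.fst_swap, Prod.snd_swap, add_comm]
  rw [recOpInv_eq_swap]
  refine Prod.ext (funext fun n => ?_) (funext fun n => ?_)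
  · rw [Prod.fst_swap, recOp_snd, h1, h2]
    simp only [pInt_swap_recOp θ hu hh, qInt_recOp θ hu hh, Prod.snd_swap, recOp_fst,
      sub_add_cancel, gammaSq]
    ring
  · rw [Prod.snd_swap, recOp_fst, h1, h2]
    simp only [pInt_swap_recOp θ hu hh, qInt_recOp θ hu hh, Prod.fst_swap, recOp_snd,
      add_sub_cancel_right, gammaSq]
    ring

theorem recOp_recOpInv (hu : Admissible u) (hh : Rapid h) :
    recOp θ u (recOpInv θ u h) = h := by
  have := recOpInv_recOp θ hu.swap hh.swap
  rw [recOpInv_eq_swap, Prod.swap_swap] at this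
  rw [recOpInv_eq_swap, ← Prod.swap_inj, this]

/-! ### Heredity of `L`. -/

/-- `qSrc u h` is formally the derivative of -log γ² in the direction `h`, so `dqSrc` is a second
derivative and hence symmetric. -/
theorem dqSrc_comm (u g h : Vec) : dqSrc u g h = dqSrc u h g :=
  funext fun n => by simp only [dqSrc]; ring

theorem dqInt_comm (u g h : Vec) : dqInt θ u g h = dqInt θ u h g :=
  congrArg (invShift θ) (dqSrc_comm u g h)

/-- The antisymmetric part of the summand is a total difference, so its sum is local. -/
theorem pInt_comm (hg : Rapid g) (hh : Rapid h) (n : ℤ) :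
    pInt θ g h n = pInt θ h g n + (g.2 (n - 1) * h.1 n - h.2 (n - 1) * g.1 n) := by
  refine invShift_of_sub θ (hg.pSrc hh) (hh.pSrc hg)
    (((hg.2.shift_sub 1).mul hh.1).sub ((hh.2.shift_sub 1).mul hg.1)) (fun m => ?_) n
  simp only [pSrc, add_sub_cancel_right]
  ring

/-- Antisymmetrization removes the sums that involve `g` and `h` jointly: the `dqInt` terms cancel
and the `pInt` terms become local. Only sums linear in `g` or in `h` alone remain. -/
theorem dRecOp_sub_fst (hg : Rapid g) (hh : Rapid h) (n : ℤ) :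
    (dRecOp θ u g h - dRecOp θ u h g).1 n =
      -(g.1 n * pInt θ u h (n + 1) - h.1 n * pInt θ u g (n + 1))
      - u.1 n * (g.2 n * h.1 (n + 1) - h.2 n * g.1 (n + 1))
      + (u.2 n * g.1 n + u.1 n * g.2 n) * u.1 (n + 1) * qInt θ u h (n + 1)
      - (u.2 n * h.1 n + u.1 n * h.2 n) * u.1 (n + 1) * qInt θ u g (n + 1)
      - gammaSq u n * (g.1 (n + 1) * qInt θ u h (n + 1) - h.1 (n + 1) * qInt θ u g (n + 1)) := by
  simp only [dRecOp, Prod.fst_sub, Pi.sub_apply, pInt_comm θ hg hh, dqInt_comm θ u g h,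
    add_sub_cancel_right, dGammaSq]
  ring

theorem dRecOp_sub_snd (hg : Rapid g) (hh : Rapid h) (n : ℤ) :
    (dRecOp θ u g h - dRecOp θ u h g).2 n =
      g.2 n * pInt θ u h n - h.2 n * pInt θ u g n
      + u.2 n * (g.2 (n - 1) * h.1 n - h.2 (n - 1) * g.1 n)
      - (u.2 n * g.1 n + u.1 n * g.2 n) * u.2 (n - 1) * qInt θ u h n
      + (u.2 n * h.1 n + u.1 n * h.2 n) * u.2 (n - 1) * qInt θ u g n
      + gammaSq u n * (g.2 (n - 1) * qInt θ u h n - h.2 (n - 1) * qInt θ u g n) := by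
  simp only [dRecOp, Prod.snd_sub, Pi.sub_apply, pInt_comm θ hg hh, dqInt_comm θ u g h, dGammaSq]
  ring

/-- The second nonlocal term at the antisymmetrized derivative of `recOp`. -/
theorem qInt_dRecOp_sub (hu : Admissible u) (hg : Rapid g) (hh : Rapid h) (n : ℤ) :
    qInt θ u (dRecOp θ u g h - dRecOp θ u h g) n =
      dqInt θ u (recOp θ u g) h n - dqInt θ u (recOp θ u h) g n
      + (g.2 (n - 1) * h.1 n - h.2 (n - 1) * g.1 n
        - (u.2 (n - 1) * g.1 n + u.1 n * g.2 (n - 1)) * qInt θ u h n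
        + (u.2 (n - 1) * h.1 n + u.1 n * h.2 (n - 1)) * qInt θ u g n) := by
  have hR := hu.rapid
  have k1 := hu.dqSrc (hg.recOp θ hu) hh
  have k2 := hu.dqSrc (hh.recOp θ hu) hg
  -- The telescoping term. Its factors `qInt` are only bounded; the decay comes from their
  -- coefficients.
  have hY : RapidSeq fun n : ℤ => (g.2 (n - 1) * h.1 n - h.2 (n - 1) * g.1 n
        - (u.2 (n - 1) * g.1 n + u.1 n * g.2 (n - 1)) * qInt θ u h n
        + (u.2 (n - 1) * h.1 n + u.1 n * h.2 (n - 1)) * qInt θ u g n) :=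
    ((((hg.2.shift_sub 1).mul hh.1).sub ((hh.2.shift_sub 1).mul hg.1)).sub
      ((((hR.2.shift_sub 1).mul hg.1).add (hR.1.mul (hg.2.shift_sub 1))).mul_bounded
        (hu.qInt θ hh))).add
      ((((hR.2.shift_sub 1).mul hh.1).add (hR.1.mul (hh.2.shift_sub 1))).mul_bounded
        (hu.qInt θ hg))
  have e := invShift_of_sub θ (hu.qSrc ((hu.dRecOp θ hg hh).sub (hu.dRecOp θ hh hg)))
    (k1.sub k2) hY (fun m => ?_) n
  · rw [invShift_sub θ k1.summable k2.summable] at e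
    exact e
  · simp only [qSrc, dqSrc, dRecOp_sub_fst θ hg hh, dRecOp_sub_snd θ hg hh, recOp_fst, recOp_snd,
      add_sub_cancel_right, pInt_succ θ hR hh, pInt_succ θ hR hg, qInt_succ θ hu hh,
      qInt_succ θ hu hg]
    have h0 := hu.ne_zero m
    field_simp
    simp only [gammaSq]
    ring

/-- The coefficient of the local part of the first nonlocal term at the antisymmetrized
derivative of `recOp`. -/
def pCoeff (u g : Vec) (n : ℤ) : ℂ :=
  u.2 (n - 1) * (u.1 (n + 1) * (u.2 n * g.1 n + u.1 n * g.2 n) - gammaSq u n * g.1 (n + 1))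
  + u.1 n * (u.2 (n - 1 - 1) * (u.2 (n - 1) * g.1 (n - 1) + u.1 (n - 1) * g.2 (n - 1))
    - gammaSq u (n - 1) * g.2 (n - 1 - 1))

theorem Admissible.pCoeff (hu : Admissible u) (hg : Rapid g) : RapidSeq (pCoeff u g) := by
  have hR := hu.rapid
  have hs := (hR.2.mul hg.1).add (hR.1.mul hg.2)
  exact ((hR.2.shift_sub 1).mul (((hR.1.shift 1).mul hs).sub
      (hu.bounded_gammaSq.mul_rapid (hg.1.shift 1)))).add
    (hR.1.mul ((((hR.2.shift_sub 1).shift_sub 1).mul (hs.shift_sub 1)).sub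
      ((hu.bounded_gammaSq.shift_sub 1).mul_rapid ((hg.2.shift_sub 1).shift_sub 1))))

/-- The first nonlocal term at the antisymmetrized derivative of `recOp`. -/
theorem pInt_dRecOp_sub (hu : Admissible u) (hg : Rapid g) (hh : Rapid h) (n : ℤ) :
    pInt θ u (dRecOp θ u g h - dRecOp θ u h g) n =
      pInt θ (recOp θ u g) h n - pInt θ (recOp θ u h) g n
      + (u.1 n * u.2 (n - 1) * (g.2 (n - 1) * h.1 n - h.2 (n - 1) * g.1 n)
        + pCoeff u g n * qInt θ u h n - pCoeff u h n * qInt θ u g n) := by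
  have hR := hu.rapid
  have k1 := (hg.recOp θ hu).pSrc hh
  have k2 := (hh.recOp θ hu).pSrc hg
  have hY : RapidSeq fun n : ℤ =>
      (u.1 n * u.2 (n - 1) * (g.2 (n - 1) * h.1 n - h.2 (n - 1) * g.1 n)
        + pCoeff u g n * qInt θ u h n - pCoeff u h n * qInt θ u g n) :=
    (((hR.1.mul (hR.2.shift_sub 1)).mul (((hg.2.shift_sub 1).mul hh.1).sub
      ((hh.2.shift_sub 1).mul hg.1))).add ((hu.pCoeff hg).mul_bounded (hu.qInt θ hh))).sub
      ((hu.pCoeff hh).mul_bounded (hu.qInt θ hg))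
  have e := invShift_of_sub θ (hR.pSrc ((hu.dRecOp θ hg hh).sub (hu.dRecOp θ hh hg)))
    (k1.sub k2) hY (fun m => ?_) n
  · rw [invShift_sub θ k1.summable k2.summable] at e
    exact e
  · simp only [pSrc, pCoeff, dRecOp_sub_fst θ hg hh, dRecOp_sub_snd θ hg hh, recOp_fst, recOp_snd,
      add_sub_cancel_right, pInt_succ θ hR hh, pInt_succ θ hR hg, qInt_succ θ hu hh,
      qInt_succ θ hu hg, pInt_pred θ hR hh, pInt_pred θ hR hg, qInt_pred θ hu hh,
      qInt_pred θ hu hg]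
    have h0 := hu.ne_zero m
    have h1 := hu.ne_zero (m + 1)
    have h2 := hu.ne_zero (m - 1)
    field_simp
    simp only [gammaSq]
    ring

/-- `recOp` is hereditary. -/
theorem recOp_hereditary (hu : Admissible u) (hg : Rapid g) (hh : Rapid h) :
    recOp θ u (dRecOp θ u g h - dRecOp θ u h g) =
      dRecOp θ u (recOp θ u g) h - dRecOp θ u (recOp θ u h) g := by
  have hR := hu.rapid
  refine Prod.ext (funext fun n => ?_) (funext fun n => ?_)
  -- The sums pairing `Lg` with `h` and `Lh` with `g` now occur identically on both sides. What
  -- remains is a rational identity in the values of the sequences and of the single sums at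
  -- neighbouring sites.
  · rw [recOp_fst, pInt_dRecOp_sub θ hu hg hh, qInt_dRecOp_sub θ hu hg hh,
      dRecOp_sub_fst θ hg hh]
    simp only [dRecOp, Prod.fst_sub, Pi.sub_apply, dGammaSq, recOp_fst, recOp_snd, pCoeff,
      add_sub_cancel_right, pInt_succ θ hR hh, pInt_succ θ hR hg, qInt_succ θ hu hh,
      qInt_succ θ hu hg]
    have h0 := hu.ne_zero n
    have h1 := hu.ne_zero (n + 1)
    field_simp
    simp only [gammaSq]
    ring
  · rw [recOp_snd, pInt_dRecOp_sub θ hu hg hh, qInt_dRecOp_sub θ hu hg hh,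
      dRecOp_sub_snd θ hg hh]
    simp only [dRecOp, Prod.snd_sub, Pi.sub_apply, dGammaSq, recOp_fst, recOp_snd, pCoeff,
      add_sub_cancel_right, pInt_succ θ hR hh, pInt_succ θ hR hg,
      qInt_succ θ hu hh, qInt_succ θ hu hg, pInt_pred θ hR hh, pInt_pred θ hR hg,
      qInt_pred θ hu hh, qInt_pred θ hu hg]
    have h0 := hu.ne_zero n
    have h1 := hu.ne_zero (n - 1)
    field_simp
    simp only [gammaSq]
    ring

end

/-! ### `L`, L⁻¹ and L' as endomorphisms of the Schwartz space. -/

/-- The space of pairs of rapidly vanishing sequences. -/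
def rapidSpace : Submodule ℂ Vec where
  carrier := {f | Rapid f}
  add_mem' := Rapid.add
  zero_mem' := Rapid.zero
  smul_mem' c _ hf := hf.smul c

/-- The Schwartz space of pairs of rapidly vanishing sequences, as a type. -/
def RapidVec : Type := {f : Vec // Rapid f}

namespace RapidVec

instance : AddCommGroup RapidVec := inferInstanceAs (AddCommGroup rapidSpace)

instance : Module ℂ RapidVec := inferInstanceAs (Module ℂ rapidSpace)

instance : CoeOut RapidVec Vec := ⟨Subtype.val⟩

theorem ext {f g : RapidVec} (h : (f : Vec) = g) : f = g := Subtype.ext h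

theorem coe_add (f g : RapidVec) : ((f + g : RapidVec) : Vec) = f + g := rfl

theorem coe_sub (f g : RapidVec) : ((f - g : RapidVec) : Vec) = f - g := rfl

theorem coe_zero : ((0 : RapidVec) : Vec) = 0 := rfl

end RapidVec

section

variable {u g g' h h' : Vec} (θ : ℂ)

theorem pInt_add_right (hu : Rapid u) (hh : Rapid h) (hh' : Rapid h') (n : ℤ) :
    pInt θ u (h + h') n = pInt θ u h n + pInt θ u h' n := by
  rw [pInt, pInt, pInt, ← invShift_add θ (hu.pSrc hh).summable (hu.pSrc hh').summable]
  congr 1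
  funext m
  simp only [pSrc, Prod.fst_add, Prod.snd_add, Pi.add_apply]
  ring

theorem pInt_add_left (hg : Rapid g) (hg' : Rapid g') (hh : Rapid h) (n : ℤ) :
    pInt θ (g + g') h n = pInt θ g h n + pInt θ g' h n := by
  rw [pInt, pInt, pInt, ← invShift_add θ (hg.pSrc hh).summable (hg'.pSrc hh).summable]
  congr 1
  funext m
  simp only [pSrc, Prod.fst_add, Prod.snd_add, Pi.add_apply]
  ring

theorem qInt_add (hu : Admissible u) (hh : Rapid h) (hh' : Rapid h') (n : ℤ) :
    qInt θ u (h + h') n = qInt θ u h n + qInt θ u h' n := by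
  rw [qInt, qInt, qInt, ← invShift_add θ (hu.qSrc hh).summable (hu.qSrc hh').summable]
  congr 1
  funext m
  simp only [qSrc, Prod.fst_add, Prod.snd_add, Pi.add_apply]
  ring

theorem dqInt_add (hu : Admissible u) (hg : Rapid g) (hg' : Rapid g') (hh : Rapid h) (n : ℤ) :
    dqInt θ u (g + g') h n = dqInt θ u g h n + dqInt θ u g' h n := by
  rw [dqInt, dqInt, dqInt, ← invShift_add θ (hu.dqSrc hg hh).summable (hu.dqSrc hg' hh).summable]
  congr 1
  funext m
  simp only [dqSrc, qSrc, Prod.fst_add, Prod.snd_add, Pi.add_apply]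
  ring

variable (u g h)

theorem pInt_smul_right (c : ℂ) (n : ℤ) : pInt θ u (c • h) n = c * pInt θ u h n := by
  rw [pInt, pInt, ← invShift_const_mul]
  congr 1
  funext m
  simp only [pSrc, Prod.smul_fst, Prod.smul_snd, Pi.smul_apply, smul_eq_mul]
  ring

theorem pInt_smul_left (c : ℂ) (n : ℤ) : pInt θ (c • g) h n = c * pInt θ g h n := by
  rw [pInt, pInt, ← invShift_const_mul]
  congr 1
  funext m
  simp only [pSrc, Prod.smul_fst, Prod.smul_snd, Pi.smul_apply, smul_eq_mul]
  ring

theorem qInt_smul (c : ℂ) (n : ℤ) : qInt θ u (c • h) n = c * qInt θ u h n := by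
  rw [qInt, qInt, ← invShift_const_mul]
  congr 1
  funext m
  simp only [qSrc, Prod.smul_fst, Prod.smul_snd, Pi.smul_apply, smul_eq_mul]
  ring

theorem dqInt_smul (c : ℂ) (n : ℤ) : dqInt θ u (c • g) h n = c * dqInt θ u g h n := by
  rw [dqInt, dqInt, ← invShift_const_mul]
  congr 1
  funext m
  simp only [dqSrc, qSrc, Prod.smul_fst, Prod.smul_snd, Pi.smul_apply, smul_eq_mul]
  ring

variable {u g h}

theorem recOp_add (hu : Admissible u) (hh : Rapid h) (hh' : Rapid h') :
    recOp θ u (h + h') = recOp θ u h + recOp θ u h' := by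
  refine Prod.ext (funext fun n => ?_) (funext fun n => ?_)
  · simp only [Prod.fst_add, Pi.add_apply, recOp_fst, pInt_add_right θ hu.rapid hh hh',
      qInt_add θ hu hh hh']
    ring
  · simp only [Prod.snd_add, Pi.add_apply, recOp_snd, pInt_add_right θ hu.rapid hh hh',
      qInt_add θ hu hh hh']
    ring

theorem recOp_smul (u h : Vec) (c : ℂ) : recOp θ u (c • h) = c • recOp θ u h := by
  refine Prod.ext (funext fun n => ?_) (funext fun n => ?_)
  · simp only [Prod.smul_fst, Pi.smul_apply, recOp_fst, pInt_smul_right, qInt_smul, smul_eq_mul]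
    ring
  · simp only [Prod.smul_snd, Pi.smul_apply, recOp_snd, pInt_smul_right, qInt_smul, smul_eq_mul]
    ring

theorem dRecOp_add_left (hu : Admissible u) (hg : Rapid g) (hg' : Rapid g') (hh : Rapid h) :
    dRecOp θ u (g + g') h = dRecOp θ u g h + dRecOp θ u g' h := by
  refine Prod.ext (funext fun n => ?_) (funext fun n => ?_)
  · simp only [dRecOp, dGammaSq, Prod.fst_add, Prod.snd_add, Pi.add_apply,
      pInt_add_left θ hg hg' hh, dqInt_add θ hu hg hg' hh]
    ring
  · simp only [dRecOp, dGammaSq, Prod.fst_add, Prod.snd_add, Pi.add_apply,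
      pInt_add_left θ hg hg' hh, dqInt_add θ hu hg hg' hh]
    ring

theorem dRecOp_smul_left (u g h : Vec) (c : ℂ) : dRecOp θ u (c • g) h = c • dRecOp θ u g h := by
  refine Prod.ext (funext fun n => ?_) (funext fun n => ?_)
  · simp only [dRecOp, dGammaSq, Prod.smul_fst, Prod.smul_snd, Pi.smul_apply, pInt_smul_left,
      dqInt_smul, smul_eq_mul]
    ring
  · simp only [dRecOp, dGammaSq, Prod.smul_fst, Prod.smul_snd, Pi.smul_apply, pInt_smul_left,
      dqInt_smul, smul_eq_mul]
    ring

/-- `recOp` as an endomorphism of the Schwartz space. -/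
def recEnd (hu : Admissible u) : Module.End ℂ RapidVec where
  toFun h := ⟨recOp θ u h, Rapid.recOp θ hu h.2⟩
  map_add' h k := RapidVec.ext (recOp_add θ hu h.2 k.2)
  map_smul' c h := RapidVec.ext (recOp_smul θ u h c)

/-- The coordinate swap on the Schwartz space. -/
def swapEnd : Module.End ℂ RapidVec where
  toFun h := ⟨h.1.swap, h.2.swap⟩
  map_add' _ _ := rfl
  map_smul' _ _ := rfl

/-- `recOpInv` as an endomorphism of the Schwartz space. -/
def recInvEnd (hu : Admissible u) : Module.End ℂ RapidVec :=
  swapEnd * recEnd θ hu.swap * swapEnd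

theorem coe_recEnd (hu : Admissible u) (h : RapidVec) :
    (recEnd θ hu h : Vec) = recOp θ u h := rfl

theorem coe_recInvEnd (hu : Admissible u) (h : RapidVec) :
    (recInvEnd θ hu h : Vec) = recOpInv θ u h :=
  (recOpInv_eq_swap θ u h).symm

theorem recEnd_mul_recInvEnd (hu : Admissible u) : recEnd θ hu * recInvEnd θ hu = 1 :=
  LinearMap.ext fun h => RapidVec.ext <| by
    rw [Module.End.mul_apply, coe_recEnd, coe_recInvEnd, recOp_recOpInv θ hu h.2,
      Module.End.one_apply]

theorem recInvEnd_mul_recEnd (hu : Admissible u) : recInvEnd θ hu * recEnd θ hu = 1 :=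
  LinearMap.ext fun h => RapidVec.ext <| by
    rw [Module.End.mul_apply, coe_recInvEnd, coe_recEnd, recOpInv_recOp θ hu h.2,
      Module.End.one_apply]

/-- The derivative of `recOp θ · h` at `u`, as an endomorphism of the Schwartz space. -/
def dRecEnd (hu : Admissible u) (h : RapidVec) : Module.End ℂ RapidVec where
  toFun g := ⟨dRecOp θ u g h, hu.dRecOp θ g.2 h.2⟩
  map_add' g k := RapidVec.ext (dRecOp_add_left θ hu g.2 k.2 h.2)
  map_smul' c g := RapidVec.ext (dRecOp_smul_left θ u g h c)

theorem recEnd_hereditary (hu : Admissible u) (g h : RapidVec) :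
    recEnd θ hu (dRecEnd θ hu h g - dRecEnd θ hu g h) =
      dRecEnd θ hu h (recEnd θ hu g) - dRecEnd θ hu g (recEnd θ hu h) :=
  RapidVec.ext (recOp_hereditary θ hu g.2 h.2)

theorem VecJet.congr {F H : ℝ → Vec} {F₀ F₁ : Vec} (hF : VecJet F F₀ F₁)
    (h : ∀ᶠ ε in 𝓝 (0 : ℝ), H ε = F ε) : VecJet H F₀ F₁ :=
  ⟨fun k => (hF.1 k).congr (h.mono fun ε hε n => by rw [hε]) (fun _ => rfl) fun _ => rfl,
    fun k => (hF.2 k).congr (h.mono fun ε hε n => by rw [hε]) (fun _ => rfl) fun _ => rfl⟩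

/-- γ² is bounded away from 0 and moves by O(ε) uniformly in the site. This makes L L⁻¹ = I
available along the whole line near ε = 0, so that it can be differentiated. -/
theorem Admissible.eventually_line (hu : Admissible u) (hg : Rapid g) :
    ∀ᶠ ε : ℝ in 𝓝 0, Admissible (u + (ε : ℂ) • g) := by
  obtain ⟨C, hC⟩ := (VecJet.line hu.rapid hg).gammaSq.eventually_norm_inv_le hu.bounded_inv
    hu.ne_zero
  filter_upwards [hC] with ε hε
  exact ⟨hu.rapid.add (hg.smul _), fun n => (hε n).1⟩

theorem VecJet.recOpInv {v H : ℝ → Vec} (hu : Admissible u) (hv : VecJet v u g)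
    (hH : VecJet H h h') :
    VecJet (fun ε => recOpInv θ (v ε) (H ε)) (recOpInv θ u h)
      ((dRecOp θ u.swap g.swap h.swap).swap + recOpInv θ u h') := by
  simp only [recOpInv_eq_swap]
  exact (hv.swap.recOp θ hu.swap hH.swap).swap

/-- The derivative of `recOpInv θ · h` at `u` in terms of that of `recOp`. -/
theorem swap_dRecOp_swap (hu : Admissible u) (g h : RapidVec) :
    (dRecOp θ u.swap (g : Vec).swap (h : Vec).swap).swap =
      -(recInvEnd θ hu (dRecEnd θ hu (recInvEnd θ hu h) g) : Vec) := by
  set X : RapidVec := ⟨_, (hu.swap.dRecOp θ g.2.swap h.2.swap).swap⟩ with hX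
  have hv := VecJet.line hu.rapid g.2
  have e1 := hv.recOpInv θ hu (VecJet.const h.2)
  rw [show recOpInv θ u 0 = 0 from
    (coe_recInvEnd θ hu 0).symm.trans (by rw [map_zero, RapidVec.coe_zero]), add_zero] at e1
  have e2 := hv.recOp θ hu e1
  -- The curve L L⁻¹h is constantly `h` near ε = 0, so its Leibniz derivative L'[g]L⁻¹h + LX
  -- vanishes, with X the derivative of L⁻¹h.
  have e3 := ((VecJet.const h.2).congr ((hu.eventually_line g.2).mono fun ε hε =>
    recOp_recOpInv θ hε h.2)).unique e2
  have e4 : dRecEnd θ hu (recInvEnd θ hu h) g + recEnd θ hu X = 0 := by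
    refine RapidVec.ext ?_
    rw [RapidVec.coe_add, RapidVec.coe_zero, e3, ← coe_recInvEnd θ hu h]
    rfl
  have e5 : X = -recInvEnd θ hu (dRecEnd θ hu (recInvEnd θ hu h) g) := by
    have := congrArg (recInvEnd θ hu) (eq_neg_of_add_eq_zero_right e4)
    rwa [map_neg, ← Module.End.mul_apply, recInvEnd_mul_recEnd, Module.End.one_apply] at this
  exact congrArg Subtype.val e5

end

/-! ### Gateaux derivatives of vector fields, and Lie derivatives of `L`. -/

/-- The vector field `F` has the value `F₀` at `u`, and `F'` is its derivative there, with
first-order expansions along lines in the Schwartz space. -/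
def HasGateaux (F : Vec → Vec) (u : Vec) (F₀ : RapidVec) (F' : Module.End ℂ RapidVec) : Prop :=
  ∀ g : RapidVec, VecJet (fun ε => F (u + (ε : ℂ) • (g : Vec))) F₀ (F' g)

namespace HasGateaux

variable {F H : Vec → Vec} {u : Vec} {F₀ H₀ : RapidVec} {F' H' : Module.End ℂ RapidVec}

theorem apply_eq (hF : HasGateaux F u F₀ F') : F u = F₀ := by
  have h := hF 0
  refine Prod.ext (funext fun n => ?_) (funext fun n => ?_)
  · simpa using (h.1 0).apply_zero n
  · simpa using (h.2 0).apply_zero n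

theorem gateaux_eq (hF : HasGateaux F u F₀ F') (g : RapidVec) : gateaux F u g = F' g :=
  Prod.ext (funext fun n => (((hF g).1 0).hasDerivAt n).deriv)
    (funext fun n => (((hF g).2 0).hasDerivAt n).deriv)

theorem regular (hF : HasGateaux F u F₀ F') : Regular F u := by
  refine ⟨hF.apply_eq ▸ F₀.2, fun g hg => ⟨fun n => ?_, ?_⟩⟩
  · exact ⟨(((hF ⟨g, hg⟩).1 0).hasDerivAt n).differentiableAt,
      (((hF ⟨g, hg⟩).2 0).hasDerivAt n).differentiableAt⟩
  · rw [hF.gateaux_eq ⟨g, hg⟩]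
    exact (F' ⟨g, hg⟩).2

theorem const (h : RapidVec) : HasGateaux (fun _ => h) u h 0 := fun _ => VecJet.const h.2

theorem add (hF : HasGateaux F u F₀ F') (hH : HasGateaux H u H₀ H') :
    HasGateaux (fun v => F v + H v) u (F₀ + H₀) (F' + H') := fun g => (hF g).add (hH g)

theorem sub (hF : HasGateaux F u F₀ F') (hH : HasGateaux H u H₀ H') :
    HasGateaux (fun v => F v - H v) u (F₀ - H₀) (F' - H') := fun g => (hF g).sub (hH g)

theorem smul (hF : HasGateaux F u F₀ F') (c : ℂ) :
    HasGateaux (fun v => c • F v) u (c • F₀) (c • F') := fun g => (hF g).smul c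

theorem recOp (θ : ℂ) (hu : Admissible u) (hF : HasGateaux F u F₀ F') :
    HasGateaux (fun v => recOp θ v (F v)) u (recEnd θ hu F₀)
      (dRecEnd θ hu F₀ + recEnd θ hu * F') :=
  fun g => (VecJet.line hu.rapid g.2).recOp θ hu (hF g)

theorem recOpInv (θ : ℂ) (hu : Admissible u) (hF : HasGateaux F u F₀ F') :
    HasGateaux (fun v => recOpInv θ v (F v)) u (recInvEnd θ hu F₀)
      (-(recInvEnd θ hu * dRecEnd θ hu (recInvEnd θ hu F₀)) + recInvEnd θ hu * F') := fun g => by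
  have h := (VecJet.line hu.rapid g.2).recOpInv θ hu (hF g)
  rwa [swap_dRecOp_swap θ hu, ← coe_recInvEnd θ hu, ← coe_recInvEnd θ hu] at h

theorem of_linear (T : Module.End ℂ RapidVec) (hu : Rapid u)
    (hF : ∀ (g : RapidVec), F g = T g) : HasGateaux F u (T ⟨u, hu⟩) T := fun g => by
  refine (VecJet.line (T ⟨u, hu⟩).2 (T g).2).congr (Eventually.of_forall fun ε => ?_)
  have h (w : RapidVec) : T (w + (ε : ℂ) • g) = T w + (ε : ℂ) • T g := by rw [map_add, map_smul]
  exact (hF (⟨u, hu⟩ + (ε : ℂ) • g)).trans (congrArg Subtype.val (h ⟨u, hu⟩))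

end HasGateaux

section

variable {u : Vec} (θ : ℂ) (hu : Admissible u)

/-- `calL` as an endomorphism of the Schwartz space. -/
def calEnd : Module.End ℂ RapidVec :=
  recEnd θ hu - (2 : ℂ) • (1 : Module.End ℂ RapidVec) + recInvEnd θ hu

theorem coe_calEnd (h : RapidVec) : (calEnd θ hu h : Vec) = calL θ u h := by
  rw [calL, ← coe_recEnd θ hu, ← coe_recInvEnd θ hu]
  rfl

theorem coe_calEnd_pow (m : ℕ) (h : RapidVec) :
    ((calEnd θ hu ^ m) h : Vec) = (calL θ u)^[m] h := by
  induction m with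
  | zero => rfl
  | succ m ih => rw [pow_succ', Module.End.mul_apply, coe_calEnd, ih, Function.iterate_succ_apply']

theorem HasGateaux.calL {F : Vec → Vec} {F₀ : RapidVec} {F' : Module.End ℂ RapidVec}
    (hF : HasGateaux F u F₀ F') :
    HasGateaux (fun v => calL θ v (F v)) u (calEnd θ hu F₀)
      (dRecEnd θ hu F₀ + recEnd θ hu * F' - (2 : ℂ) • F'
        + (-(recInvEnd θ hu * dRecEnd θ hu (recInvEnd θ hu F₀)) + recInvEnd θ hu * F')) :=
  ((hF.recOp θ hu).sub (hF.smul 2)).add (hF.recOpInv θ hu)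

/-- The endomorphism `A` is the Lie derivative `L'[F] - [F', L]` of the operator `recOp` along the
differentiable vector field `F`. -/
def HasLieDeriv (F : Vec → Vec) (A : Module.End ℂ RapidVec) : Prop :=
  ∃ F₀ F', HasGateaux F u F₀ F' ∧
    ∀ h, dRecEnd θ hu h F₀ - (F' (recEnd θ hu h) - recEnd θ hu (F' h)) = A h

theorem recInvEnd_recEnd_apply (h : RapidVec) : recInvEnd θ hu (recEnd θ hu h) = h := by
  rw [← Module.End.mul_apply, recInvEnd_mul_recEnd, Module.End.one_apply]

theorem recEnd_recInvEnd_apply (h : RapidVec) : recEnd θ hu (recInvEnd θ hu h) = h := by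
  rw [← Module.End.mul_apply, recEnd_mul_recInvEnd, Module.End.one_apply]

end

namespace HasLieDeriv

variable {u : Vec} {θ : ℂ} {hu : Admissible u} {F H : Vec → Vec} {A B : Module.End ℂ RapidVec}

theorem add (hF : HasLieDeriv θ hu F A) (hH : HasLieDeriv θ hu H B) :
    HasLieDeriv θ hu (fun v => F v + H v) (A + B) := by
  obtain ⟨F₀, F', hF, h1⟩ := hF
  obtain ⟨H₀, H', hH, h2⟩ := hH
  refine ⟨_, _, hF.add hH, fun h => ?_⟩
  simp only [LinearMap.add_apply, map_add, ← h1, ← h2]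
  abel

theorem smul (hF : HasLieDeriv θ hu F A) (c : ℂ) :
    HasLieDeriv θ hu (fun v => c • F v) (c • A) := by
  obtain ⟨F₀, F', hF, h1⟩ := hF
  refine ⟨_, _, hF.smul c, fun h => ?_⟩
  simp only [LinearMap.smul_apply, map_smul, ← h1, smul_sub]

theorem sub (hF : HasLieDeriv θ hu F A) (hH : HasLieDeriv θ hu H B) :
    HasLieDeriv θ hu (fun v => F v - H v) (A - B) := by
  simpa only [neg_smul, one_smul, ← sub_eq_add_neg] using hF.add (hH.smul (-1))

/-- Since (LF)'[h] = L'[h]F + LF'[h], heredity applied to `F` and `h` lets one factor `L` be pulled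
out of the whole Lie derivative. -/
theorem recOp (hF : HasLieDeriv θ hu F A) :
    HasLieDeriv θ hu (fun v => recOp θ v (F v)) (recEnd θ hu * A) := by
  obtain ⟨F₀, F', hF, h1⟩ := hF
  refine ⟨_, _, hF.recOp θ hu, fun h => ?_⟩
  have h2 := recEnd_hereditary θ hu F₀ h
  simp only [map_sub] at h2
  simp only [LinearMap.add_apply, Module.End.mul_apply, map_add, ← h1, map_sub]
  linear_combination (norm := module) -h2

/-- Heredity applied to L⁻¹F and `h`, then multiplied by L⁻¹, handles the term -L⁻¹L'[h]L⁻¹F from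
the derivative of the inverse. -/
theorem recOpInv (hF : HasLieDeriv θ hu F A) :
    HasLieDeriv θ hu (fun v => recOpInv θ v (F v)) (recInvEnd θ hu * A) := by
  obtain ⟨F₀, F', hF, h1⟩ := hF
  refine ⟨_, _, hF.recOpInv θ hu, fun h => ?_⟩
  have h2 := congrArg (recInvEnd θ hu) (recEnd_hereditary θ hu (recInvEnd θ hu F₀) h)
  rw [recInvEnd_recEnd_apply, recEnd_recInvEnd_apply] at h2
  simp only [map_sub] at h2
  simp only [LinearMap.add_apply, LinearMap.neg_apply, Module.End.mul_apply, map_add, map_neg,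
    ← h1, map_sub, recInvEnd_recEnd_apply, recEnd_recInvEnd_apply]
  linear_combination (norm := module) h2

theorem calL (hF : HasLieDeriv θ hu F A) :
    HasLieDeriv θ hu (fun v => calL θ v (F v)) (calEnd θ hu * A) := by
  have h := (hF.recOp.sub (hF.smul 2)).add hF.recOpInv
  rwa [show recEnd θ hu * A - (2 : ℂ) • A + recInvEnd θ hu * A = calEnd θ hu * A by
    rw [calEnd, add_mul, sub_mul, smul_mul_assoc, one_mul]] at h

theorem iterate (hF : HasLieDeriv θ hu F A) (m : ℕ) :
    HasLieDeriv θ hu (fun v => (AblowitzLadik.calL θ v)^[m] (F v)) (calEnd θ hu ^ m * A) := by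
  induction m with
  | zero => simpa using hF
  | succ m ih => simpa only [Function.iterate_succ_apply', pow_succ', mul_assoc] using ih.calL

theorem regular (hF : HasLieDeriv θ hu F A) : Regular F u :=
  let ⟨_, _, h, _⟩ := hF
  h.regular

/-- The Lie derivative of `calL` in terms of the one of `recOp`. -/
theorem opGateaux_sub_comm (hF : HasLieDeriv θ hu F A) (h : RapidVec) :
    opGateaux (AblowitzLadik.calL θ) u (F u) h
      - comm (gateaux F u) (AblowitzLadik.calL θ u) h =
    ((A - recInvEnd θ hu * A * recInvEnd θ hu) h : RapidVec) := by
  obtain ⟨F₀, F', hF, h1⟩ := hF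
  have e1 := ((HasGateaux.const h).calL θ hu).gateaux_eq F₀
  have h2 := h1 h
  -- Evaluating A at L⁻¹h and applying L⁻¹ gives, up to sign, the Lie derivative of L⁻¹; the term
  -- -2I contributes nothing.
  have h3 := congrArg (recInvEnd θ hu) (h1 (recInvEnd θ hu h))
  rw [recEnd_recInvEnd_apply, map_sub, map_sub, recInvEnd_recEnd_apply] at h3
  rw [opGateaux, comm, hF.apply_eq, e1, hF.gateaux_eq h, ← coe_calEnd θ hu, ← coe_calEnd θ hu,
    hF.gateaux_eq, ← RapidVec.coe_sub, ← RapidVec.coe_sub]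
  refine congrArg Subtype.val ?_
  simp only [calEnd, LinearMap.add_apply, LinearMap.sub_apply, LinearMap.neg_apply,
    LinearMap.smul_apply, LinearMap.zero_apply, Module.End.mul_apply, Module.End.one_apply,
    map_add, map_sub, map_smul, smul_zero, mul_zero, ← h3, ← h2]
  abel

end HasLieDeriv

/-! ### The seeds K⁽⁰⁾ and σ⁽⁰⁾ and the flows they generate. -/

section

variable {u h : Vec} (θ : ℂ)

/-- The linear vector field `K0` on the Schwartz space. -/
def K0End : Module.End ℂ RapidVec where
  toFun h := ⟨K0 h, h.2.1, h.2.2.neg⟩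
  map_add' _ _ := RapidVec.ext <| Prod.ext rfl (neg_add _ _)
  map_smul' c _ := RapidVec.ext <| Prod.ext rfl (smul_neg c _).symm

theorem sigma0_add (h k : Vec) : sigma0 (h + k) = sigma0 h + sigma0 k :=
  Prod.ext (funext fun _ => mul_add _ _ _)
    (funext fun _ => (congrArg Neg.neg (mul_add _ _ _)).trans (neg_add _ _))

theorem sigma0_smul (c : ℂ) (h : Vec) : sigma0 (c • h) = c • sigma0 h :=
  Prod.ext (funext fun _ => mul_left_comm _ _ _)
    (funext fun _ => (congrArg Neg.neg (mul_left_comm _ _ _)).trans (mul_neg _ _).symm)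

/-- The linear vector field `sigma0` on the Schwartz space. -/
def sigma0End : Module.End ℂ RapidVec where
  toFun h := ⟨sigma0 h,
    (((h.2.1.int_mul).const_mul 2).add h.2.1).congr_fun fun n => by simp only [sigma0]; ring,
    (((h.2.2.int_mul).const_mul 2).add h.2.2).neg.congr_fun fun n => by simp only [sigma0]; ring⟩
  map_add' h k := RapidVec.ext (sigma0_add h k)
  map_smul' c h := RapidVec.ext (sigma0_smul c h)

theorem Rapid.sigma0 (hh : Rapid h) : Rapid (sigma0 h) := (sigma0End ⟨h, hh⟩).2

theorem pInt_K0 (u h : Vec) (n : ℤ) : pInt θ u (K0 h) n = -pInt θ (K0 u) h n := by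
  rw [pInt, pInt, ← invShift_neg]
  congr 1
  funext m
  simp only [pSrc, K0, Pi.neg_apply]
  ring

theorem qInt_K0 (u h : Vec) (n : ℤ) : qInt θ u (K0 h) n = -dqInt θ u (K0 u) h n := by
  rw [qInt, dqInt, ← invShift_neg]
  congr 1
  funext m
  simp only [dqSrc, qSrc, K0, Pi.neg_apply]
  ring

/-- Infinitesimal form of a symmetry: scaling first components by c and second components by c⁻¹, in
`u` and in `h`, preserves γ² and commutes with `L`. -/
theorem dRecOp_K0 (u h : Vec) :
    dRecOp θ u (K0 u) h - (K0 (recOp θ u h) - recOp θ u (K0 h)) = 0 := by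
  refine Prod.ext (funext fun n => ?_) (funext fun n => ?_)
  · simp only [dRecOp, dGammaSq, Prod.fst_sub, Pi.sub_apply, recOp_fst, pInt_K0, qInt_K0,
      Prod.fst_zero, Pi.zero_apply]
    simp only [K0, Pi.neg_apply, recOp_fst]
    ring
  · simp only [dRecOp, dGammaSq, Prod.snd_sub, Pi.sub_apply, recOp_snd, pInt_K0, qInt_K0,
      Prod.snd_zero, Pi.zero_apply]
    simp only [K0, Pi.neg_apply, recOp_snd]
    ring

theorem pInt_sigma0 (hu : Rapid u) (hh : Rapid h) (n : ℤ) :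
    pInt θ u (sigma0 h) n = 2 * pInt θ u h n - pInt θ (sigma0 u) h n := by
  rw [pInt, pInt, pInt, ← invShift_const_mul,
    ← invShift_sub θ ((hu.pSrc hh).summable.mul_left 2) (hu.sigma0.pSrc hh).summable]
  congr 1
  funext m
  simp only [pSrc, sigma0]
  push_cast
  ring

theorem qInt_sigma0 (u h : Vec) (n : ℤ) : qInt θ u (sigma0 h) n = -dqInt θ u (sigma0 u) h n := by
  rw [qInt, dqInt, ← invShift_neg]
  congr 1
  funext m
  simp only [dqSrc, qSrc, sigma0]
  ring

/-- Formally, scale the two components at site n by c^(2n+1) and c^(-(2n+1)). Then γ² is unchanged,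
while E on first components and E⁻¹ on second components each gain c². So `L` is conjugated into
c²L, and differentiating at c = 1 produces 2L. -/
theorem dRecOp_sigma0 (hu : Rapid u) (hh : Rapid h) :
    dRecOp θ u (sigma0 u) h - (sigma0 (recOp θ u h) - recOp θ u (sigma0 h)) =
      (2 : ℂ) • recOp θ u h := by
  refine Prod.ext (funext fun n => ?_) (funext fun n => ?_)
  · simp only [dRecOp, dGammaSq, Prod.fst_sub, Pi.sub_apply, recOp_fst, pInt_sigma0 θ hu hh,
      qInt_sigma0, Prod.smul_fst, Pi.smul_apply, smul_eq_mul]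
    simp only [sigma0, recOp_fst]
    push_cast
    ring
  · simp only [dRecOp, dGammaSq, Prod.snd_sub, Pi.sub_apply, recOp_snd, pInt_sigma0 θ hu hh,
      qInt_sigma0, Prod.smul_snd, Pi.smul_apply, smul_eq_mul]
    simp only [sigma0, recOp_snd]
    push_cast
    ring

variable (hu : Admissible u)

theorem hasLieDeriv_K0 : HasLieDeriv θ hu K0 0 :=
  ⟨_, _, HasGateaux.of_linear K0End hu.rapid fun _ => rfl,
    fun h => RapidVec.ext (dRecOp_K0 θ u h)⟩

theorem hasLieDeriv_sigma0 : HasLieDeriv θ hu sigma0 ((2 : ℂ) • recEnd θ hu) :=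
  ⟨_, _, HasGateaux.of_linear sigma0End hu.rapid fun _ => rfl,
    fun h => RapidVec.ext (dRecOp_sigma0 θ hu.rapid h.2)⟩

theorem hasLieDeriv_Kflow (j : Fin 2) (m : ℕ) : HasLieDeriv θ hu (Kflow θ j m) 0 := by
  have h : HasLieDeriv θ hu (Kinit θ j) 0 := by
    have h0 := hasLieDeriv_K0 θ hu
    by_cases hj : j = 0
    · exact (funext fun v => if_pos hj : Kinit θ j = K0) ▸ h0
    · have h1 := (h0.recOp.sub h0.recOpInv).smul (1 / 2)
      rw [mul_zero, mul_zero, sub_zero, smul_zero] at h1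
      exact (funext fun v => if_neg hj : Kinit θ j = fun v => (1 / 2 : ℂ) •
        (recOp θ v (K0 v) - recOpInv θ v (K0 v))) ▸ h1
  have hm := h.iterate m
  rw [mul_zero] at hm
  exact hm

theorem hasLieDeriv_sigmaFlow_zero (m : ℕ) :
    HasLieDeriv θ hu (sigmaFlow θ 0 m) (calEnd θ hu ^ m * recEnd θ hu) := by
  have h := (hasLieDeriv_sigma0 θ hu).smul (1 / 2)
  rw [smul_smul, div_mul_cancel₀ _ (two_ne_zero' ℂ), one_smul] at h
  exact h.iterate m

theorem hasLieDeriv_sigmaFlow_one (m : ℕ) :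
    HasLieDeriv θ hu (sigmaFlow θ 1 m)
      (calEnd θ hu ^ m * ((1 / 2 : ℂ) • (recEnd θ hu * recEnd θ hu - 1))) := by
  have h0 := hasLieDeriv_sigma0 θ hu
  have h := (h0.recOp.sub h0.recOpInv).smul (1 / 4)
  -- ¼(L - L⁻¹)·2L = ½(L² - I).
  rw [mul_smul_comm, mul_smul_comm, recInvEnd_mul_recEnd, ← smul_sub, smul_smul,
    show (1 / 4 * 2 : ℂ) = 1 / 2 by norm_num] at h
  exact h.iterate m

/-! ### From Lie derivatives of `L` to those of 𝓛. -/

theorem commute_calEnd_recInvEnd : Commute (calEnd θ hu) (recInvEnd θ hu) := by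
  have h : Commute (recEnd θ hu) (recInvEnd θ hu) :=
    (recEnd_mul_recInvEnd θ hu).trans (recInvEnd_mul_recEnd θ hu).symm
  exact (h.sub_left ((Commute.one_left _).smul_left 2)).add_left (Commute.refl _)

/-- Conjugation by `recInvEnd` passes through powers of `calEnd`. -/
theorem calEnd_pow_mul_sub (m : ℕ) (B : Module.End ℂ RapidVec) :
    calEnd θ hu ^ m * B - recInvEnd θ hu * (calEnd θ hu ^ m * B) * recInvEnd θ hu =
      calEnd θ hu ^ m * (B - recInvEnd θ hu * B * recInvEnd θ hu) := by
  rw [← mul_assoc (recInvEnd θ hu), ← ((commute_calEnd_recInvEnd θ hu).pow_left m).eq, mul_sub]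
  simp only [mul_assoc]

/-- The left side is ½(L² - 2I + L⁻²) = ½((L + L⁻¹)² - 4I), and L + L⁻¹ = 𝓛 + 2I. -/
theorem half_sq_add_two_mul_calEnd :
    (1 / 2 : ℂ) • (recEnd θ hu * recEnd θ hu - 1)
      - recInvEnd θ hu * ((1 / 2 : ℂ) • (recEnd θ hu * recEnd θ hu - 1)) * recInvEnd θ hu =
    (1 / 2 : ℂ) • calEnd θ hu ^ 2 + (2 : ℂ) • calEnd θ hu := by
  have h1 := recEnd_mul_recInvEnd θ hu
  have h2 := recInvEnd_mul_recEnd θ hu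
  have h3 : recInvEnd θ hu * (recEnd θ hu * recEnd θ hu) * recInvEnd θ hu = 1 := by
    rw [← mul_assoc, h2, one_mul, h1]
  rw [mul_smul_comm, smul_mul_assoc, mul_sub, sub_mul, h3, mul_one, calEnd, sq]
  simp only [mul_add, add_mul, mul_sub, sub_mul, h1, h2, mul_smul_comm, smul_mul_assoc, mul_one,
    one_mul]
  module

end

end AblowitzLadik

end

/-! ### The main theorem. -/

theorem mainTheorem5 (θ : ℂ) (u : AblowitzLadik.Vec) (hu : AblowitzLadik.Rapid u)
    (hγ : ∀ n : ℤ, AblowitzLadik.gammaSq u n ≠ 0) :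
    -- the objects in the identities are well defined
    (∀ h, AblowitzLadik.Rapid h →
      AblowitzLadik.recOp θ u (AblowitzLadik.recOpInv θ u h) = h ∧
      AblowitzLadik.recOpInv θ u (AblowitzLadik.recOp θ u h) = h ∧
      AblowitzLadik.Regular (fun v => AblowitzLadik.recOp θ v h) u ∧
      AblowitzLadik.Regular (fun v => AblowitzLadik.recOpInv θ v h) u ∧
      AblowitzLadik.Regular (fun v => AblowitzLadik.calL θ v h) u) ∧
    (∀ (j : Fin 2) (m : ℕ),
      AblowitzLadik.Regular (AblowitzLadik.Kflow θ j m) u ∧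
      AblowitzLadik.Regular (AblowitzLadik.sigmaFlow θ j m) u) ∧
    -- the three operator identities, applied to an arbitrary rapidly vanishing `h`
    (∀ (m : ℕ) (h : AblowitzLadik.Vec), AblowitzLadik.Rapid h →
      (∀ j : Fin 2,
        AblowitzLadik.opGateaux (AblowitzLadik.calL θ) u (AblowitzLadik.Kflow θ j m u) h
          - AblowitzLadik.comm (AblowitzLadik.gateaux (AblowitzLadik.Kflow θ j m) u)
              (AblowitzLadik.calL θ u) h = 0) ∧
      AblowitzLadik.opGateaux (AblowitzLadik.calL θ) u (AblowitzLadik.sigmaFlow θ 0 m u) h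
          - AblowitzLadik.comm (AblowitzLadik.gateaux (AblowitzLadik.sigmaFlow θ 0 m) u)
              (AblowitzLadik.calL θ u) h
        = (AblowitzLadik.calL θ u)^[m]
            (AblowitzLadik.recOp θ u h - AblowitzLadik.recOpInv θ u h) ∧
      AblowitzLadik.opGateaux (AblowitzLadik.calL θ) u (AblowitzLadik.sigmaFlow θ 1 m u) h
          - AblowitzLadik.comm (AblowitzLadik.gateaux (AblowitzLadik.sigmaFlow θ 1 m) u)
              (AblowitzLadik.calL θ u) h
        = (1 / 2 : ℂ) • (AblowitzLadik.calL θ u)^[m + 2] h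
          + (2 : ℂ) • (AblowitzLadik.calL θ u)^[m + 1] h) := by
  have h1 : AblowitzLadik.Admissible u := ⟨hu, hγ⟩
  refine ⟨fun h hh => ?_, fun j m => ⟨?_, ?_⟩, fun m h hh => ?_⟩
  · have hc := AblowitzLadik.HasGateaux.const (u := u) ⟨h, hh⟩
    exact ⟨AblowitzLadik.recOp_recOpInv θ h1 hh, AblowitzLadik.recOpInv_recOp θ h1 hh,
      (hc.recOp θ h1).regular, (hc.recOpInv θ h1).regular, (hc.calL θ h1).regular⟩
  · exact (AblowitzLadik.hasLieDeriv_Kflow θ h1 j m).regular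
  · match j with
    | 0 => exact (AblowitzLadik.hasLieDeriv_sigmaFlow_zero θ h1 m).regular
    | 1 => exact (AblowitzLadik.hasLieDeriv_sigmaFlow_one θ h1 m).regular
  obtain ⟨w, rfl⟩ : ∃ w : AblowitzLadik.RapidVec, (w : AblowitzLadik.Vec) = h := ⟨⟨h, hh⟩, rfl⟩
  refine ⟨fun j => ?_, ?_, ?_⟩
  · have e := (AblowitzLadik.hasLieDeriv_Kflow θ h1 j m).opGateaux_sub_comm w
    rw [mul_zero, zero_mul, sub_zero] at e
    exact e
  · have e := (AblowitzLadik.hasLieDeriv_sigmaFlow_zero θ h1 m).opGateaux_sub_comm w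
    rw [AblowitzLadik.calEnd_pow_mul_sub, AblowitzLadik.recInvEnd_mul_recEnd, one_mul,
      Module.End.mul_apply, AblowitzLadik.coe_calEnd_pow] at e
    rw [← AblowitzLadik.coe_recInvEnd θ h1 w]
    exact e
  · have e := (AblowitzLadik.hasLieDeriv_sigmaFlow_one θ h1 m).opGateaux_sub_comm w
    rw [AblowitzLadik.calEnd_pow_mul_sub, AblowitzLadik.half_sq_add_two_mul_calEnd, mul_add,
      mul_smul_comm, mul_smul_comm, ← pow_add, ← pow_succ] at e
    have e1 := AblowitzLadik.coe_calEnd_pow θ h1 (m + 2) w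
    have e2 := AblowitzLadik.coe_calEnd_pow θ h1 (m + 1) w
    rw [← e1, ← e2]
    exact e
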